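/- Let $n\ge 1$ be an integer. For an integer $m\ge 1$ put $\zeta_m=e^{2\pi\sqrt{-1}/m}$. An $(m,n)$-generalized bent function, or $(m,n)$-GBF, is a function $f:\mathbb{Z}_2^n\to\mathbb{Z}_m$ such that $$\Bigl|\sum_{x\in\mathbb{Z}_2^n}\zeta_m^{f(x)}(-1)^{y\cdot x}\Bigr|^2=2^n\qquad\text{for all } y\in\mathbb{Z}_2^n,$$ where $y\cdot x$ is the usual inner product. Let $m=\prod_{i=1}^s p_i^{\alpha_i}$, where $p_1<p_2<\cdots<p_s$ are odd primes and all $\alpha_i$ are positive integers. Then: (a) If $s=1$, there is no $(m,n)$-GBF. (b) If $s\ge 2$ and $3p_1+p_2>2^n$, there is no $(m,n)$-GBF. (c) Suppose that $0\le r<s$ and that $p_{r+1}$ is the smallest prime factor $q$ of $m$ with $p_1+q>2^n$. If there is no $\bigl(\prod_{i=1}^r p_i^{\alpha_i},n\bigr)$-GBF, then there is no $(m,n)$-GBF. -/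

import Mathlib

/-- The root of unity `ζ_m = exp (2π√-1 / m)`. -/
noncomputable def gbfZeta (m : ℕ) : ℂ :=
  Complex.exp (2 * Real.pi * Complex.I / m)

/-- The transform `F(y) = ∑_{x ∈ ℤ₂ⁿ} ζ_m ^ f(x) (-1) ^ (y · x)` of `f : ℤ₂ⁿ → ℤ_m`.
Exponents are taken through their least nonnegative representatives. -/
noncomputable def gbfTransform (m n : ℕ) (f : (Fin n → ZMod 2) → ZMod m)
    (y : Fin n → ZMod 2) : ℂ :=
  ∑ x : Fin n → ZMod 2, gbfZeta m ^ (f x).val * (-1 : ℂ) ^ (y ⬝ᵥ x).val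

/-- `f : ℤ₂ⁿ → ℤ_m` is an `(m, n)`-generalized bent function: `|F(y)|² = 2ⁿ` for all `y`. -/
def IsGBF (m n : ℕ) (f : (Fin n → ZMod 2) → ZMod m) : Prop :=
  ∀ y : Fin n → ZMod 2, ‖gbfTransform m n f y‖ ^ 2 = (2 : ℝ) ^ n

/-! Put G = ℤ/m. Fourier inversion on ℤ₂ⁿ turns bentness of f into the vanishing of every
autocorrelation ∑ₓ ζ^(f(x+v)-f(x)) with v ≠ 0. Each is a vanishing sum of 2ⁿ roots of unity of odd
order, whose multiplicity function D on G is symmetric under negation and has D(0) even because x ↦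
x+v is a fixed-point-free involution. The theorem thus becomes one about short vanishing sums.

The main tool is `slice_eq_slice_add`. If G = H × ℤ/qᵃ⁺¹ with q prime to |H|, Galois conjugation
shows that the slices of a vanishing relation take equal values in the cyclotomic ring of H along
each coset of the subgroup of order q. Induction on the primes then gives two facts when the primes
are P or at least Q: equal sums x, y with x short satisfy x ≤ y pointwise unless y is long
(`shortDominated_zmod`), and a nonempty vanishing sum with fewer than 3P + Q terms contains a full
coset of prime order (`containsPrimeCoset_of_charSum_eq_zero`).

For (b), D is therefore a sum of prime-order cosets. Parity and size leave exactly two, of distinct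
prime orders, and symmetry makes them subgroups. So all differences of values of f are 0 or of prime
order, while two distinct primes occur in one direction v; `false_of_prime_order_differences`
excludes this.

For (c), when 2ⁿ < p₁ + q every slice of D over the q-primary factor vanishes separately, so the
prime-to-q component of f is, up to a unit multiplier, again bent. Large primes are removed one at a
time. For (a), evaluating at 1 a polynomial divisible by the cyclotomic polynomial of qᵃ⁺¹ gives q ∣
2ⁿ. -/

open Finset

/-! ### Characters of cyclic groups, Galois conjugation and slices -/

/-- Every complex additive character of `ZMod N` is a multiplicative shift of the standard one. -/
lemma AddChar.exists_eq_stdAddChar_mul {N : ℕ} [NeZero N] (ψ : AddChar (ZMod N) ℂ) :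
    ∃ u : ZMod N, ∀ h, ψ h = ZMod.stdAddChar (u * h) := by
  have h1 : ψ 1 ^ N = 1 := by
    rw [← AddChar.map_nsmul_eq_pow]; simp
  have hprim : IsPrimitiveRoot (ZMod.stdAddChar (1 : ZMod N)) N := by
    have := ZMod.stdAddChar_coe (N := N) 1
    simp only [Int.cast_one, mul_one] at this
    rw [this]
    exact Complex.isPrimitiveRoot_exp N (NeZero.ne N)
  obtain ⟨i, -, hi⟩ := hprim.eq_pow_of_pow_eq_one h1
  refine ⟨i, fun h => ?_⟩
  have hh : h = h.val • (1 : ZMod N) := by simp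
  rw [hh, AddChar.map_nsmul_eq_pow, ← hi, ← AddChar.map_nsmul_eq_pow, ← AddChar.map_nsmul_eq_pow]
  congr 1
  simp [mul_comm]

lemma isUnit_of_injective_stdAddChar_mul {N : ℕ} [NeZero N] {ψ : AddChar (ZMod N) ℂ}
    (hψ : Function.Injective ψ) {u : ZMod N} (hu : ∀ h, ψ h = ZMod.stdAddChar (u * h)) :
    IsUnit u := by
  have hinj : Function.Injective (fun h : ZMod N => u * h) := by
    intro a b hab
    apply hψ
    rw [hu, hu]
    exact congrArg _ hab
  obtain ⟨v, hv⟩ := (Finite.injective_iff_surjective.1 hinj) 1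
  exact IsUnit.of_mul_eq_one v hv

/-- A rational linear relation between values of a character is preserved by raising the values
to a power coprime to the order of the group. -/
lemma sum_intCast_mul_addChar_pow_eq_zero {G : Type*} [AddCommGroup G] [Fintype G]
    (ψ : AddChar G ℂ) (z : G → ℤ) (hz : ∑ g, (z g : ℂ) * ψ g = 0) {w : ℕ}
    (hw : w.Coprime (Fintype.card G)) : ∑ g, (z g : ℂ) * ψ g ^ w = 0 := by
  set m := Fintype.card G with hm
  have hm0 : m ≠ 0 := Fintype.card_ne_zero
  have hprim := Complex.isPrimitiveRoot_exp m hm0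
  set ζ := Complex.exp (2 * Real.pi * Complex.I / m) with hζ
  have hex : ∀ g, ∃ i : ℕ, ζ ^ i = ψ g := by
    intro g
    have : ψ g ^ m = 1 := by
      rw [← AddChar.map_nsmul_eq_pow, hm, card_nsmul_eq_zero, AddChar.map_zero_eq_one]
    have : NeZero m := ⟨hm0⟩
    obtain ⟨i, -, hi⟩ := hprim.eq_pow_of_pow_eq_one ‹ψ g ^ m = 1›
    exact ⟨i, hi⟩
  choose e he using hex
  let P : Polynomial ℤ := ∑ g, Polynomial.C (z g) * Polynomial.X ^ e g
  have haeval : ∀ x : ℂ, Polynomial.aeval x P = ∑ g, (z g : ℂ) * x ^ e g := by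
    intro x; simp [P]
  have h0 : Polynomial.aeval ζ P = 0 := by
    rw [haeval, ← hz]
    exact Finset.sum_congr rfl fun g _ => by rw [he]
  have hdvd : Polynomial.cyclotomic m ℤ ∣ P := by
    rw [Polynomial.cyclotomic_eq_minpoly hprim (Nat.pos_of_ne_zero hm0)]
    exact minpoly.isIntegrallyClosed_dvd (hprim.isIntegral (Nat.pos_of_ne_zero hm0)) h0
  obtain ⟨Q, hQ⟩ := hdvd
  have hprim' := hprim.pow_of_coprime w hw
  have hroot : Polynomial.aeval (ζ ^ w) (Polynomial.cyclotomic m ℤ) = 0 := by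
    rw [Polynomial.cyclotomic_eq_minpoly hprim' (Nat.pos_of_ne_zero hm0)]
    exact minpoly.aeval _ _
  have h1 : Polynomial.aeval (ζ ^ w) P = 0 := by rw [hQ, map_mul, hroot, zero_mul]
  rw [haeval] at h1
  rw [← h1]
  refine Finset.sum_congr rfl fun g _ => ?_
  rw [← he, ← pow_mul, ← pow_mul, mul_comm w]

/-- The restriction of a character of `H × C` to the first factor. -/
def AddChar.fstRestrict {H C : Type*} [AddCommGroup H] [AddCommGroup C]
    (ψ : AddChar (H × C) ℂ) : AddChar H ℂ :=
  ψ.compAddMonoidHom (AddMonoidHom.inl H C)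

lemma AddChar.fstRestrict_injective {H C : Type*} [AddCommGroup H] [AddCommGroup C]
    {ψ : AddChar (H × C) ℂ} (hψ : Function.Injective ψ) :
    Function.Injective ψ.fstRestrict := by
  intro a b hab
  simpa using hψ hab

/-- In a vanishing relation over `H × ℤ/qᵃ⁺¹` the slices are constant, as elements of the
cyclotomic ring of `H`, along the translates of the subgroup of order `q`. -/
theorem slice_eq_slice_add {H : Type*} [AddCommGroup H] [Fintype H] {q a n : ℕ} (hq : q.Prime)
    [NeZero n] (hn : n = q ^ (a + 1))
    (hcop : q.Coprime (Fintype.card H)) (ψ : AddChar (H × ZMod n) ℂ)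
    (hψ : Function.Injective ψ) (z : H × ZMod n → ℤ)
    (hz : ∑ g, (z g : ℂ) * ψ g = 0) (j : ZMod n) :
    ∑ h, (z (h, j) : ℂ) * ψ.fstRestrict h =
      ∑ h, (z (h, j + (q ^ a : ℕ)) : ℂ) * ψ.fstRestrict h := by
  let t : ZMod n := (q ^ a : ℕ)
  let c : ZMod n → ℂ := fun j => ∑ h, (z (h, j) : ℂ) * ψ.fstRestrict h
  let χ : AddChar (ZMod n) ℂ := ψ.compAddMonoidHom (AddMonoidHom.inr H (ZMod n))
  have hχ : Function.Injective χ := fun x y hxy => by simpa using hψ hxy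
  have hsplit : ∀ h k, ψ (h, k) = ψ.fstRestrict h * χ k := by
    intro h k
    have : ((h, k) : H × ZMod n) = (h, 0) + (0, k) := by simp
    rw [this, AddChar.map_add_eq_mul]; rfl
  obtain ⟨v, hv⟩ := AddChar.exists_eq_stdAddChar_mul χ
  obtain ⟨v, rfl⟩ := isUnit_of_injective_stdAddChar_mul hχ hv
  -- The conjugation exponent is w ≡ 1 mod |H| and w ≡ u·v⁻¹ mod n: it fixes the values on H and
  -- moves χ to the character of parameter u. Hence the Fourier transform of the slice values c
  -- vanishes at all units.
  have hunit : ∀ u : (ZMod n)ˣ, ∑ j, c j * ZMod.stdAddChar ((u : ZMod n) * j) = 0 := by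
    intro u
    have hcop' : (Fintype.card H).Coprime n := hn ▸ (Nat.Coprime.pow_left _ hcop).symm
    obtain ⟨w, hw1, hw2⟩ := Nat.chineseRemainder hcop' 1 ((u * v⁻¹ : (ZMod n)ˣ) : ZMod n).val
    have hwH : w.Coprime (Fintype.card H) := by
      rw [Nat.Coprime, hw1.gcd_eq]; simp
    have hwn' : (w : ZMod n) = ((u * v⁻¹ : (ZMod n)ˣ) : ZMod n) := by
      rw [(ZMod.natCast_eq_natCast_iff _ _ _).2 hw2]; simp
    have hwn : w.Coprime n := by
      rw [← ZMod.isUnit_iff_coprime, hwn']; exact Units.isUnit _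
    have := sum_intCast_mul_addChar_pow_eq_zero ψ z hz (w := w) (by
      rw [Fintype.card_prod, ZMod.card]; exact Nat.Coprime.mul_right hwH hwn)
    rw [Fintype.sum_prod_type_right] at this
    rw [← this]
    refine Finset.sum_congr rfl fun j _ => ?_
    rw [Finset.sum_mul]
    refine Finset.sum_congr rfl fun h _ => ?_
    have e1 : ψ.fstRestrict h ^ w = ψ.fstRestrict h := by
      rw [← AddChar.map_nsmul_eq_pow]
      congr 1
      have h1 := (Nat.ModEq.of_dvd (addOrderOf_dvd_card (x := h)) hw1)
      have := (nsmul_eq_nsmul_iff_modEq (x := h)).2 h1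
      simpa using this
    have e2 : χ j ^ w = ZMod.stdAddChar ((u : ZMod n) * j) := by
      rw [← AddChar.map_nsmul_eq_pow, hv, nsmul_eq_mul, hwn']
      congr 1
      push_cast
      rw [mul_comm (u : ZMod n), mul_assoc, ← mul_assoc (v : ZMod n)]
      simp
    rw [hsplit, mul_pow, e1, e2, mul_assoc]
  let d : ZMod n → ℂ := fun j => c j - c (j + t)
  -- The transform of d is (1 - χ(tk)) times that of c, with χ the standard character. The second
  -- factor vanishes for units k; for the others q ∣ k, so tk = 0 and the first factor vanishes.
  have hd : ZMod.dft d = 0 := by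
    funext k
    rw [ZMod.dft_apply]
    have hshift : ∑ j, ZMod.stdAddChar (-(j * k)) • c (j + t) =
        ZMod.stdAddChar (t * k) * ∑ j, ZMod.stdAddChar (-(j * k)) • c j := by
      rw [← Equiv.sum_comp (Equiv.addRight t) (fun j => ZMod.stdAddChar (-(j * k)) • c j), Finset.mul_sum]
      refine Finset.sum_congr rfl fun j _ => ?_
      simp only [Equiv.coe_addRight, smul_eq_mul]
      rw [← mul_assoc, ← AddChar.map_add_eq_mul]
      congr 2; ring
    have : ∑ j, ZMod.stdAddChar (-(j * k)) • d j =
        (1 - ZMod.stdAddChar (t * k)) * ∑ j, ZMod.stdAddChar (-(j * k)) • c j := by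
      simp only [d, smul_sub, Finset.sum_sub_distrib]
      rw [hshift]; ring
    rw [this, Pi.zero_apply]
    by_cases hk : IsUnit k
    · obtain ⟨u, rfl⟩ := hk
      have := hunit (-u)
      rw [mul_eq_zero]; right
      rw [← this]
      refine Finset.sum_congr rfl fun j _ => ?_
      rw [smul_eq_mul, mul_comm]
      congr 2
      push_cast; ring
    · have : t * k = 0 := by
        have hk' : ¬ (k.val).Coprime n := by
          rw [← ZMod.isUnit_iff_coprime]; simpa using hk
        have : q ∣ k.val := by
          by_contra h
          have h' : (q ^ (a + 1)).Coprime k.val :=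
            Nat.Coprime.pow_left _ ((Nat.Prime.coprime_iff_not_dvd hq).2 h)
          rw [← hn] at h'
          exact hk' h'.symm
        obtain ⟨b, hb⟩ := this
        have : k = ((q * b : ℕ) : ZMod n) := by rw [← hb]; simp
        rw [this, ← Nat.cast_mul, ZMod.natCast_eq_zero_iff]
        exact ⟨b, by rw [hn]; ring⟩
      rw [this]; simp
  have hd0 : d = 0 := by simpa using hd
  have := congrFun hd0 j
  exact sub_eq_zero.1 this

lemma addOrderOf_pow_in_zmod {q a : ℕ} (hq : q.Prime) :
    addOrderOf ((q ^ a : ℕ) : ZMod (q ^ (a + 1))) = q := by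
  rw [ZMod.addOrderOf_coe _ (pow_ne_zero _ hq.ne_zero),
    Nat.gcd_eq_right (pow_dvd_pow q (Nat.le_succ a)), pow_succ,
    Nat.mul_div_cancel_left _ (pow_pos hq.pos a)]

/-! ### Domination and prime cosets over a product H × C -/

/-- The value of `∑ g, x g • [g]` in the group ring at a character. -/
noncomputable def charSum {G : Type*} [AddCommGroup G] [Fintype G] (ψ : AddChar G ℂ)
    (x : G → ℕ) : ℂ :=
  ∑ g, (x g : ℂ) * ψ g

section charSum

variable {G : Type*} [AddCommGroup G] [Fintype G] (ψ : AddChar G ℂ)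

lemma charSum_add (x y : G → ℕ) :
    charSum ψ (fun g => x g + y g) = charSum ψ x + charSum ψ y := by
  simp [charSum, add_mul, Finset.sum_add_distrib]

lemma charSum_eq_zero_of_sum_eq_zero {x : G → ℕ} (hx : ∑ g, x g = 0) : charSum ψ x = 0 := by
  have : ∀ g, x g = 0 := fun g => by simpa using (Finset.sum_eq_zero_iff.1 hx) g (mem_univ g)
  simp [charSum, this]

end charSum

/-- Slices of vanishing relations over `H × C` are constant along translation by `t`. -/
def SliceInvariant {H C : Type*} [AddCommGroup H] [Fintype H] [AddCommGroup C] [Fintype C]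
    (ψ : AddChar (H × C) ℂ) (t : C) : Prop :=
  ∀ z : H × C → ℤ, ∑ g, (z g : ℂ) * ψ g = 0 → ∀ j,
    ∑ h, (z (h, j) : ℂ) * ψ.fstRestrict h = ∑ h, (z (h, j + t) : ℂ) * ψ.fstRestrict h

/-- If `x` and `y` have the same value at `ψ` and `x` is short, then `x ≤ y` or `y` is long. -/
def ShortDominated {G : Type*} [AddCommGroup G] [Fintype G] (ψ : AddChar G ℂ) (P Q : ℕ) : Prop :=
  ∀ x y : G → ℕ, charSum ψ x = charSum ψ y → ∑ g, x g < P →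
    (∀ g, x g ≤ y g) ∨ (P - ∑ g, x g) * (Q - 1) ≤ ∑ g, y g

/-- If `x` and `y` have the same value at `ψ` and `x` is short, then `x ≤ y`. -/
def StronglyDominated {G : Type*} [AddCommGroup G] [Fintype G] (ψ : AddChar G ℂ) (P : ℕ) : Prop :=
  ∀ x y : G → ℕ, charSum ψ x = charSum ψ y → ∑ g, x g < P → ∀ g, x g ≤ y g

/-- The support of `D` contains a coset of a subgroup of prime order. -/
def ContainsPrimeCoset {G : Type*} [AddCommGroup G] (D : G → ℕ) : Prop :=
  ∃ g t : G, (addOrderOf t).Prime ∧ ∀ k : ℕ, 1 ≤ D (g + k • t)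

lemma add_nsmul_injOn {C : Type*} [AddCommGroup C] {t : C} (j : C) {q : ℕ} (ht : addOrderOf t = q) :
    Set.InjOn (fun i : ℕ => j + i • t) (Finset.range q : Set ℕ) := by
  intro a ha b hb hab
  exact nsmul_injOn_Iio_addOrderOf (x := t) (by simpa [ht] using ha) (by simpa [ht] using hb)
    (by simpa using hab)

lemma sum_slices_le {H C : Type*} [Fintype H] [AddCommGroup C] [Fintype C] {t : C} (x : H × C → ℕ) (j : C) {q : ℕ} (ht : addOrderOf t = q) :
    ∑ i ∈ range q, ∑ h, x (h, j + i • t) ≤ ∑ g, x g := by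
  classical
  rw [Fintype.sum_prod_type_right, ← Finset.sum_image (f := fun c => ∑ h, x (h, c))
    (s := range q) (g := fun i : ℕ => j + i • t) (add_nsmul_injOn j ht)]
  exact Finset.sum_le_sum_of_subset (Finset.subset_univ _)

lemma exists_empty_slice {H C : Type*} [Fintype H] [AddCommGroup C] [Fintype C] {t : C} {x : H × C → ℕ} {q : ℕ} (ht : addOrderOf t = q) (hx : ∑ g, x g < q)
    (j : C) : ∃ i ∈ range q, ∑ h, x (h, j + i • t) = 0 := by
  by_contra! hne
  have h1 : ∑ i ∈ range q, 1 ≤ ∑ i ∈ range q, ∑ h, x (h, j + i • t) :=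
    Finset.sum_le_sum fun i hi => Nat.one_le_iff_ne_zero.2 (hne i hi)
  have h2 := sum_slices_le x j ht
  simp at h1
  omega

section slices

variable {H C : Type*} [AddCommGroup H] [Fintype H] [AddCommGroup C] [Fintype C]
  {ψ : AddChar (H × C) ℂ} {t : C}

lemma SliceInvariant.add_nsmul (hs : SliceInvariant ψ t) {z : H × C → ℤ}
    (hz : ∑ g, (z g : ℂ) * ψ g = 0) (j : C) (i : ℕ) :
    ∑ h, (z (h, j) : ℂ) * ψ.fstRestrict h = ∑ h, (z (h, j + i • t) : ℂ) * ψ.fstRestrict h := by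
  induction i with
  | zero => simp
  | succ i ih => rw [ih, hs z hz, add_assoc, succ_nsmul]

lemma SliceInvariant.charSum_add_eq (hs : SliceInvariant ψ t) {x y : H × C → ℕ}
    (hxy : charSum ψ x = charSum ψ y) (j : C) (i : ℕ) :
    charSum ψ.fstRestrict (fun h => x (h, j)) +
        charSum ψ.fstRestrict (fun h => y (h, j + i • t)) =
      charSum ψ.fstRestrict (fun h => y (h, j)) +
        charSum ψ.fstRestrict (fun h => x (h, j + i • t)) := by
  have := hs.add_nsmul (z := fun g => (x g : ℤ) - y g) (by
    have := sub_eq_zero.2 hxy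
    simpa [charSum, sub_mul, Finset.sum_sub_distrib] using this) j i
  simp only [Int.cast_sub, Int.cast_natCast, sub_mul, Finset.sum_sub_distrib] at this
  simp only [charSum]
  linear_combination this

lemma SliceInvariant.charSum_eq (hs : SliceInvariant ψ t) {x : H × C → ℕ}
    (hx : charSum ψ x = 0) (j : C) (i : ℕ) :
    charSum ψ.fstRestrict (fun h => x (h, j)) =
      charSum ψ.fstRestrict (fun h => x (h, j + i • t)) := by
  have := hs.charSum_add_eq (x := x) (y := fun _ => 0) (by rw [hx]; simp [charSum]) j i
  simpa [charSum] using this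

/-- Domination over a cyclic group of prime power order. -/
lemma stronglyDominated_of_fst_eq {q P : ℕ} (hs : SliceInvariant ψ t) (ht : addOrderOf t = q)
    (hP : P ≤ q)
    (hH : ∀ x y : H → ℕ, charSum ψ.fstRestrict x = charSum ψ.fstRestrict y → x = y) :
    StronglyDominated ψ P := by
  rintro x y hxy hx ⟨h, j⟩
  obtain ⟨i, -, hi⟩ := exists_empty_slice ht (hx.trans_le hP) j
  have h1 := hs.charSum_add_eq hxy j i
  rw [charSum_eq_zero_of_sum_eq_zero _ hi, add_zero, ← charSum_add] at h1
  have := congrFun (hH _ _ h1) h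
  omega

/-- The counting behind `ShortDominated.prod`. Here X and Y are the sizes of x and y, s the size of
the slice of x where domination fails, c and I the numbers of nonempty and empty slices of x along
the coset, and a the least size of a slice of y over an empty slice of x. -/
lemma domination_bound {q P Q s c X Y a I : ℕ} (hPQ : P ≤ Q) (hQ : Q ≤ q) (hX : X < P)
    (hc : 1 ≤ c) (hI : I + c = q) (hs : s + c ≤ X + 1) (hs1 : 1 ≤ s)
    (h : (P ≤ s + a ∧ I * (P - s) ≤ Y) ∨ (s + a < P ∧ (P - (s + a)) * (Q - 1) + I * a ≤ Y)) :
    (P - X) * (Q - 1) ≤ Y := by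
  -- Every inequality is replaced by a slack variable, which removes truncated subtraction; the
  -- hints are the nonnegative products that remain.
  obtain ⟨u, rfl⟩ := Nat.exists_eq_add_of_lt hX
  obtain ⟨c, rfl⟩ := Nat.exists_eq_add_of_le' hc
  obtain ⟨e, he⟩ := Nat.exists_eq_add_of_le' hs
  obtain ⟨f, rfl⟩ := Nat.exists_eq_add_of_le hPQ
  obtain ⟨k, rfl⟩ := Nat.exists_eq_add_of_le hQ
  have hXe : X = e + s + c := by omega
  subst hXe
  have e1 : e + s + c + u + 1 - (e + s + c) = u + 1 := by omega
  rw [e1]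
  have e2 : e + s + c + u + 1 + f - 1 = e + s + c + u + f := by omega
  rw [e2] at h ⊢
  have hI' : I = e + s + u + f + k := by omega
  subst hI'
  rcases h with ⟨-, h⟩ | ⟨h1, h⟩
  · have e3 : e + s + c + u + 1 - s = e + c + u + 1 := by omega
    rw [e3] at h
    refine le_trans ?_ h
    obtain ⟨r, rfl⟩ := Nat.exists_eq_add_of_le' hs1
    nlinarith [Nat.zero_le (c * (e + r + f)), Nat.zero_le (k * (e + c + u + 1)),
      Nat.zero_le (e * (e + r + u + f + 1))]
  · obtain ⟨b, hb⟩ := Nat.exists_eq_add_of_lt h1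
    have e3 : e + s + c + u + 1 - (s + a) = b + 1 := by omega
    rw [e3] at h
    refine le_trans ?_ h
    have hba : (a : ℤ) = e + c + u - b := by omega
    have n1 : (0 : ℤ) ≤ a * k := by positivity
    have n2 : (0 : ℤ) ≤ c * (s + f + b) := by positivity
    have n3 : (0 : ℤ) ≤ e * (e + s + c + u + f) := by positivity
    zify
    rw [hba] at n1 ⊢
    nlinarith

/-- Domination passes from `H` to `H × C`. -/
lemma ShortDominated.prod {q P Q : ℕ} (hs : SliceInvariant ψ t) (ht : addOrderOf t = q)
    (hPQ : P ≤ Q) (hQ : Q ≤ q) (hH : ShortDominated ψ.fstRestrict P Q) :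
    ShortDominated ψ P Q := by
  classical
  intro x y hxy hx
  by_contra! hcon
  obtain ⟨⟨⟨h₀, j⟩, hbad⟩, hlong⟩ := hcon
  set sx : ℕ → ℕ := fun i => ∑ h, x (h, j + i • t) with hsx
  set sy : ℕ → ℕ := fun i => ∑ h, y (h, j + i • t) with hsy
  have hq0 : 0 < q := by omega
  -- Over an empty slice of x the relation reads x_j + y_i = y_j in values over H. Pointwise
  -- domination would give x_j ≤ y_j, contrary to the choice of h₀, so the alternatives of `hH`
  -- leave only these lower bounds.
  have hfact : ∀ i, sx i = 0 → P ≤ sx 0 + sy i ∨ (P - (sx 0 + sy i)) * (Q - 1) ≤ sy 0 := by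
    intro i hi
    by_contra! hc
    have h1 := hs.charSum_add_eq hxy j i
    rw [charSum_eq_zero_of_sum_eq_zero _ hi, add_zero, ← charSum_add] at h1
    have e0 : ∑ h, (x (h, j) + y (h, j + i • t)) = sx 0 + sy i := by
      simp [sx, sy, Finset.sum_add_distrib]
    have e1 : ∑ h, y (h, j) = sy 0 := by simp [sy]
    rcases hH _ _ h1 (by rw [e0]; exact hc.1) with h2 | h2
    · have := h2 h₀
      omega
    · rw [e0, e1] at h2
      omega
  have hsx0 : 1 ≤ sx 0 := by
    have : x (h₀, j) ≤ sx 0 := by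
      simpa [sx] using Finset.single_le_sum (f := fun h => x (h, j)) (fun _ _ => Nat.zero_le _)
        (mem_univ h₀)
    omega
  set I := (range q).filter (fun i => sx i = 0) with hI
  set J := (range q).filter (fun i => ¬ sx i = 0) with hJ
  have hIJ : #I + #J = q := by
    rw [hI, hJ, Finset.card_filter_add_card_filter_not, card_range]
  have h0J : 0 ∈ J := by simp [hJ, hq0]; omega
  have hxsum := sum_slices_le x j ht
  have hysum := sum_slices_le y j ht
  have hJc : sx 0 + #J ≤ ∑ g, x g + 1 := by
    have h1 : ∑ i ∈ J, sx i ≤ ∑ i ∈ range q, sx i :=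
      Finset.sum_le_sum_of_subset (filter_subset _ _)
    have h2 : sx 0 + #(J.erase 0) ≤ ∑ i ∈ J, sx i := by
      rw [← Finset.add_sum_erase _ _ h0J, Finset.card_eq_sum_ones]
      gcongr with i hi
      exact Nat.one_le_iff_ne_zero.2 (mem_filter.1 (mem_of_mem_erase hi)).2
    rw [Finset.card_erase_of_mem h0J] at h2
    have : 1 ≤ #J := Finset.card_pos.2 ⟨0, h0J⟩
    simp only [sx] at *
    omega
  have hIne : I.Nonempty := by
    rw [← Finset.card_pos]; omega
  have hyI : sy 0 + ∑ i ∈ I, sy i ≤ ∑ g, y g := by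
    refine le_trans ?_ hysum
    rw [← Finset.sum_insert (by simp [hI]; omega)]
    refine Finset.sum_le_sum_of_subset (insert_subset (by simpa using hq0) (filter_subset _ _))
  obtain ⟨i, hiI, hmin⟩ := Finset.exists_min_image I sy hIne
  have hmul : #I * sy i ≤ ∑ i ∈ I, sy i := by
    simpa using Finset.card_nsmul_le_sum I sy (sy i) hmin
  refine absurd (domination_bound (a := sy i) (Y := ∑ g, y g) hPQ hQ hx
    (Finset.card_pos.2 ⟨0, h0J⟩) hIJ hJc hsx0 ?_) (not_le.2 hlong)
  by_cases hcase : P ≤ sx 0 + sy i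
  · refine Or.inl ⟨hcase, ?_⟩
    have : #I * (P - sx 0) ≤ #I * sy i := Nat.mul_le_mul_left _ (by omega)
    omega
  · refine Or.inr ⟨not_le.1 hcase, ?_⟩
    have := (hfact i (mem_filter.1 hiI).2).resolve_left hcase
    omega

/-- A slice with zero value is handled over H by `ih`. Otherwise all q slices along the coset of ⟨t⟩
share a nonzero value, and the smallest is dominated pointwise by the others, so each point of its
support spans a coset of ⟨t⟩ in the support of D. The budget in `hdom` counts the compared slice y
together with q - 1 others, each at least as large as the smallest slice x. -/
lemma containsPrimeCoset_prod {q : ℕ} (hq : q.Prime) (hs : SliceInvariant ψ t)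
    (ht : addOrderOf t = q) {D : H × C → ℕ} (hD : charSum ψ D = 0) (hD0 : 0 < ∑ g, D g)
    (hdom : ∀ x y : H → ℕ, charSum ψ.fstRestrict x = charSum ψ.fstRestrict y →
      0 < ∑ h, x h → (q - 1) * ∑ h, x h + ∑ h, y h ≤ ∑ g, D g → ∑ h, x h ≤ ∑ h, y h →
      ∀ h, x h ≤ y h)
    (ih : ∀ x : H → ℕ, charSum ψ.fstRestrict x = 0 → 0 < ∑ h, x h → ∑ h, x h ≤ ∑ g, D g →
      ContainsPrimeCoset x) : ContainsPrimeCoset D := by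
  classical
  obtain ⟨⟨h₀, j⟩, -, hg⟩ := Finset.exists_ne_zero_of_sum_ne_zero hD0.ne'
  have hslice : ∀ c : C, ∑ h, D (h, c) ≤ ∑ g, D g := by
    intro c
    rw [Fintype.sum_prod_type_right]
    exact Finset.single_le_sum (f := fun c => ∑ h, D (h, c)) (fun _ _ => Nat.zero_le _)
      (mem_univ c)
  by_cases h0 : charSum ψ.fstRestrict (fun h => D (h, j)) = 0
  · obtain ⟨g, s, hs', hk⟩ := ih _ h0 (by
      refine lt_of_lt_of_le (Nat.pos_of_ne_zero hg)
        (Finset.single_le_sum (f := fun h => D (h, j)) (fun _ _ => Nat.zero_le _) (mem_univ h₀)))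
      (hslice j)
    refine ⟨(g, j), (s, 0), ?_, fun k => by simpa using hk k⟩
    rw [Prod.addOrderOf_mk]
    simpa using hs'
  · set S : ℕ → ℕ := fun i => ∑ h, D (h, j + i • t) with hS
    have hSpos : ∀ i, 0 < S i := by
      intro i
      refine Nat.pos_of_ne_zero fun h => h0 ?_
      rw [hs.charSum_eq hD j i]
      exact charSum_eq_zero_of_sum_eq_zero _ h
    obtain ⟨m, hm, hmin⟩ := Finset.exists_min_image (range q) S ⟨0, by simpa using hq.pos⟩
    have hle : ∀ i ∈ range q, ∀ h, D (h, j + m • t) ≤ D (h, j + i • t) := by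
      intro i hi
      refine hdom _ _ ?_ (hSpos m) ?_ (hmin i hi)
      · rw [← hs.charSum_eq hD j m, ← hs.charSum_eq hD j i]
      · refine le_trans ?_ (sum_slices_le D j ht)
        rw [← Finset.add_sum_erase _ _ hi, add_comm]
        refine add_le_add le_rfl ?_
        have := Finset.card_nsmul_le_sum ((range q).erase i) S (S m)
          (fun k hk => hmin k (mem_of_mem_erase hk))
        simpa [Finset.card_erase_of_mem hi] using this
    obtain ⟨h₁, -, hh₁⟩ := Finset.exists_ne_zero_of_sum_ne_zero (hSpos m).ne'
    refine ⟨(h₁, j), (0, t), ?_, fun k => ?_⟩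
    · rw [Prod.addOrderOf_mk]
      simpa [ht] using hq
    · have := hle (k % q) (mem_range.2 (Nat.mod_lt _ hq.pos)) h₁
      rw [← ht, mod_addOrderOf_nsmul] at this
      simp only [Prod.smul_mk, smul_zero, Prod.mk_add_mk, add_zero]
      exact (Nat.one_le_iff_ne_zero.2 hh₁).trans this

end slices

/-! ### Short vanishing sums of m-th roots of unity -/

section transport

variable {G G' : Type*} [AddCommGroup G] [Fintype G] [AddCommGroup G'] [Fintype G']

lemma charSum_comp_symm (e : G ≃+ G') (ψ : AddChar G ℂ) (x : G → ℕ) :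
    charSum (ψ.compAddMonoidHom (e.symm : G' →+ G)) (fun g => x (e.symm g)) = charSum ψ x :=
  e.symm.toEquiv.sum_comp (fun g => (x g : ℂ) * ψ g)

lemma sum_comp_addEquiv_symm (e : G ≃+ G') (x : G → ℕ) : ∑ g, x (e.symm g) = ∑ g, x g :=
  e.symm.toEquiv.sum_comp x

lemma compAddMonoidHom_symm_injective {G G' : Type*} [AddCommGroup G] [AddCommGroup G'] (e : G ≃+ G') {ψ : AddChar G ℂ}
    (hψ : Function.Injective ψ) :
    Function.Injective (ψ.compAddMonoidHom (e.symm : G' →+ G)) :=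
  hψ.comp e.symm.injective

lemma ShortDominated.of_equiv (e : G ≃+ G') {ψ : AddChar G ℂ} {P Q : ℕ}
    (h : ShortDominated (ψ.compAddMonoidHom (e.symm : G' →+ G)) P Q) : ShortDominated ψ P Q := by
  intro x y hxy hx
  have := h (fun g => x (e.symm g)) (fun g => y (e.symm g))
    (by rw [charSum_comp_symm, charSum_comp_symm, hxy]) (by rwa [sum_comp_addEquiv_symm])
  rw [sum_comp_addEquiv_symm, sum_comp_addEquiv_symm] at this
  exact this.imp (fun H g => by simpa using H (e g)) id

lemma StronglyDominated.of_equiv (e : G ≃+ G') {ψ : AddChar G ℂ} {P : ℕ}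
    (h : StronglyDominated (ψ.compAddMonoidHom (e.symm : G' →+ G)) P) :
    StronglyDominated ψ P := by
  intro x y hxy hx g
  simpa using h (fun g => x (e.symm g)) (fun g => y (e.symm g))
    (by rw [charSum_comp_symm, charSum_comp_symm, hxy]) (by rwa [sum_comp_addEquiv_symm]) (e g)

lemma ContainsPrimeCoset.of_equiv {G G' : Type*} [AddCommGroup G] [AddCommGroup G'] (e : G ≃+ G') {D : G → ℕ}
    (h : ContainsPrimeCoset (fun g => D (e.symm g))) : ContainsPrimeCoset D := by
  obtain ⟨g, t, ht, hk⟩ := h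
  refine ⟨e.symm g, e.symm t, ?_, fun k => by simpa using hk k⟩
  have := addOrderOf_injective (e.symm : G' →+ G) e.symm.injective t
  rw [← this] at ht
  exact ht

lemma eq_of_charSum_eq_of_subsingleton [Subsingleton G] (ψ : AddChar G ℂ) {x y : G → ℕ}
    (h : charSum ψ x = charSum ψ y) : x = y := by
  have hu : (univ : Finset G) = {0} := by
    ext g; simp [Subsingleton.elim g 0]
  funext g
  rw [Subsingleton.elim g 0]
  simpa [charSum, hu] using h

end transport

/-- The Chinese remainder splitting of `ZMod m` as an additive equivalence. -/
def zmodSplit {m' n : ℕ} (h : m'.Coprime n) : ZMod (m' * n) ≃+ ZMod m' × ZMod n :=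
  (ZMod.chineseRemainder h).toAddEquiv

lemma exists_primePow_split {m q : ℕ} (hm : m ≠ 0) (hq : q.Prime) (hqm : q ∣ m) :
    ∃ m' a, m = m' * q ^ (a + 1) ∧ q.Coprime m' ∧ m'.Coprime (q ^ (a + 1)) ∧ m' < m ∧
      m' ≠ 0 ∧ m' ∣ m := by
  obtain ⟨k, m', hndvd, hmeq⟩ := Nat.exists_eq_pow_mul_and_not_dvd hm q hq.ne_one
  have hk : k ≠ 0 := by
    rintro rfl
    simp at hmeq
    exact hndvd (hmeq ▸ hqm)
  obtain ⟨a, rfl⟩ := Nat.exists_eq_succ_of_ne_zero hk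
  have hcop := (Nat.Prime.coprime_iff_not_dvd hq).2 hndvd
  have hm' : m' ≠ 0 := by rintro rfl; simp at hndvd
  refine ⟨m', a, by rw [hmeq, mul_comm], hcop, (Nat.Coprime.pow_left _ hcop).symm, ?_, hm',
    hmeq ▸ dvd_mul_left _ _⟩
  rw [hmeq]
  have : 1 < q ^ (a + 1) := Nat.one_lt_pow (by omega) hq.one_lt
  have hpos : 0 < m' := Nat.pos_of_ne_zero hm'
  exact lt_mul_of_one_lt_left hpos this

lemma sliceInvariant_zmod {m' q a : ℕ} [NeZero m'] [NeZero (q ^ (a + 1))] (hq : q.Prime)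
    (hcop : q.Coprime m') (ψ : AddChar (ZMod m' × ZMod (q ^ (a + 1))) ℂ)
    (hψ : Function.Injective ψ) :
    SliceInvariant ψ ((q ^ a : ℕ) : ZMod (q ^ (a + 1))) :=
  fun z hz j => slice_eq_slice_add hq rfl (by rwa [ZMod.card]) ψ hψ z hz j

lemma subsingleton_zmod_of_eq_one {m : ℕ} (h : m = 1) : Subsingleton (ZMod m) := by
  subst h; infer_instance

/-- Only P can divide m, so splitting off its primary part leaves the trivial group, over which a
value determines its coefficient. -/
lemma stronglyDominated_zmod {m P : ℕ} [NeZero m] (hm : ∀ p, p.Prime → p ∣ m → p = P)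
    (ψ : AddChar (ZMod m) ℂ) (hψ : Function.Injective ψ) : StronglyDominated ψ P := by
  by_cases h1 : m = 1
  · have := subsingleton_zmod_of_eq_one h1
    intro x y hxy _ g
    rw [eq_of_charSum_eq_of_subsingleton ψ hxy]
  · obtain ⟨q, hq, hqm⟩ := Nat.exists_prime_and_dvd h1
    obtain rfl := hm q hq hqm
    obtain ⟨m', a, rfl, hcop, hcop', hlt, hm', -⟩ := exists_primePow_split (NeZero.ne m) hq hqm
    have : NeZero m' := ⟨hm'⟩
    have : NeZero (q ^ (a + 1)) := ⟨pow_ne_zero _ hq.ne_zero⟩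
    have hm1 : m' = 1 := by
      by_contra h
      obtain ⟨l, hl, hlm⟩ := Nat.exists_prime_and_dvd h
      obtain rfl := hm l hl (hlm.mul_right _)
      exact (Nat.Prime.coprime_iff_not_dvd hl).1 hcop hlm
    have := subsingleton_zmod_of_eq_one hm1
    refine StronglyDominated.of_equiv (zmodSplit hcop') ?_
    exact stronglyDominated_of_fst_eq (sliceInvariant_zmod hq hcop _
      (compAddMonoidHom_symm_injective _ hψ)) (addOrderOf_pow_in_zmod hq) le_rfl
      (fun x y h => eq_of_charSum_eq_of_subsingleton _ h)

/-- Primes at least Q are split off by `ShortDominated.prod` until at most P remains, where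
domination is unconditional. -/
theorem shortDominated_zmod {P Q : ℕ} (hPQ : P ≤ Q) : ∀ (m : ℕ) [NeZero m]
    (_ : ∀ p, p.Prime → p ∣ m → p = P ∨ Q ≤ p)
    (ψ : AddChar (ZMod m) ℂ) (_ : Function.Injective ψ), ShortDominated ψ P Q := by
  intro m
  induction m using Nat.strong_induction_on with
  | _ m ih =>
  intro _ hm ψ hψ
  by_cases h : ∃ q, q.Prime ∧ q ∣ m ∧ Q ≤ q
  · obtain ⟨q, hq, hqm, hQ⟩ := h
    obtain ⟨m', a, rfl, hcop, hcop', hlt, hm', hdvd⟩ :=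
      exists_primePow_split (NeZero.ne m) hq hqm
    have : NeZero m' := ⟨hm'⟩
    have : NeZero (q ^ (a + 1)) := ⟨pow_ne_zero _ hq.ne_zero⟩
    have hψ' := compAddMonoidHom_symm_injective (zmodSplit hcop') hψ
    refine ShortDominated.of_equiv (zmodSplit hcop') ?_
    exact ShortDominated.prod (sliceInvariant_zmod hq hcop _ hψ') (addOrderOf_pow_in_zmod hq)
      hPQ hQ (ih m' hlt (fun p hp hpm => hm p hp (hpm.trans hdvd)) _
        (AddChar.fstRestrict_injective hψ'))
  · push Not at h
    intro x y hxy hx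
    exact Or.inl (stronglyDominated_zmod
      (fun p hp hpm => (hm p hp hpm).resolve_right (not_le.2 (h p hp hpm))) ψ hψ x y hxy hx)

/-- A nonzero vanishing sum of `m`-th roots of unity, `m` odd, with fewer than `3P + Q` terms
contains a full coset of a subgroup of prime order. -/
theorem containsPrimeCoset_of_charSum_eq_zero {P Q : ℕ} (hP : 3 ≤ P) (hPQ : P + 2 ≤ Q) :
    ∀ (m : ℕ) [NeZero m] (_ : Odd m) (_ : ∀ p, p.Prime → p ∣ m → p = P ∨ Q ≤ p)
    (ψ : AddChar (ZMod m) ℂ) (_ : Function.Injective ψ) (D : ZMod m → ℕ)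
    (_ : charSum ψ D = 0) (_ : 0 < ∑ g, D g) (_ : ∑ g, D g < 3 * P + Q),
    ContainsPrimeCoset D := by
  intro m
  induction m using Nat.strong_induction_on with
  | _ m ih =>
  intro _ hodd hm ψ hψ D hD hD0 hDlt
  by_cases h1 : m = 1
  · have := subsingleton_zmod_of_eq_one h1
    have := eq_of_charSum_eq_of_subsingleton ψ (x := D) (y := fun _ => 0)
      (by rw [hD]; simp [charSum])
    simp [this] at hD0
  -- Taking q largest makes every prime of the cofactor m' smaller than q, which supplies the lower
  -- bounds on q below.
  obtain ⟨q, hqmem, hqmax⟩ := Finset.exists_max_image m.primeFactors id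
    (Nat.nonempty_primeFactors.2 (by have := NeZero.ne m; omega))
  have hq := Nat.prime_of_mem_primeFactors hqmem
  have hqm := Nat.dvd_of_mem_primeFactors hqmem
  have hqmax : ∀ p, p.Prime → p ∣ m → p ≤ q := fun p hp hpm =>
    hqmax p (Nat.mem_primeFactors.2 ⟨hp, hpm, NeZero.ne m⟩)
  obtain ⟨m', a, rfl, hcop, hcop', hlt, hm', hdvd⟩ := exists_primePow_split (NeZero.ne m) hq hqm
  have : NeZero m' := ⟨hm'⟩
  have : NeZero (q ^ (a + 1)) := ⟨pow_ne_zero _ hq.ne_zero⟩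
  have hψ' := compAddMonoidHom_symm_injective (zmodSplit hcop') hψ
  have hψH := AddChar.fstRestrict_injective hψ'
  have hm'p : ∀ p, p.Prime → p ∣ m' → p = P ∨ Q ≤ p := fun p hp hpm => hm p hp (hpm.trans hdvd)
  have hqodd : Odd q := hodd.of_dvd_nat hqm
  refine ContainsPrimeCoset.of_equiv (zmodSplit hcop') ?_
  refine containsPrimeCoset_prod hq (sliceInvariant_zmod hq hcop _ hψ')
    (addOrderOf_pow_in_zmod hq) (by rw [charSum_comp_symm, hD])
    (by rwa [sum_comp_addEquiv_symm]) ?_ ?_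
  · intro x y hxy hx hle hxley
    rw [sum_comp_addEquiv_symm] at hle
    set k := ∑ h, x h with hk
    obtain ⟨r, rfl⟩ := Nat.exists_eq_add_of_le' hq.one_le
    simp only [Nat.add_sub_cancel] at hle
    by_cases hm1 : m' = 1
    · have := subsingleton_zmod_of_eq_one hm1
      intro h
      rw [eq_of_charSum_eq_of_subsingleton _ hxy]
    have hne : ∀ p, p.Prime → p ∣ m' → p < r + 1 := by
      intro p hp hpm
      refine lt_of_le_of_ne (hqmax p hp (hpm.trans hdvd)) ?_
      rintro rfl
      exact (Nat.Prime.coprime_iff_not_dvd hp).1 hcop hpm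
    have hQq : Q ≤ r + 1 := by
      obtain ⟨l, hl, hlm⟩ := Nat.exists_prime_and_dvd hm1
      have h1 := hne l hl hlm
      have h2 := hm'p l hl hlm
      have h3 := hm _ hq hqm
      omega
    -- Since y is at least as large as x, k ≥ P would give PQ ≤ (q - 1)k + |y| < 3P + Q, impossible
    -- for P ≥ 3 and Q ≥ P + 2.
    have hkP : k < P := by
      by_contra! hcon
      have h1 : P * (Q - 1) ≤ r * k := by
        rw [mul_comm]; exact Nat.mul_le_mul (by omega) hcon
      have h2 : P * Q ≤ P * (Q - 1) + P := by
        obtain ⟨Q, rfl⟩ := Nat.exists_eq_add_of_le' (show 1 ≤ Q by omega)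
        simp only [Nat.add_sub_cancel]; nlinarith
      have h3 : P * Q < 3 * P + Q := by omega
      obtain ⟨b, rfl⟩ := Nat.exists_eq_add_of_le hP
      obtain ⟨c, rfl⟩ := Nat.exists_eq_add_of_le hPQ
      nlinarith [Nat.zero_le (b * c), Nat.zero_le (b * b)]
    by_cases hall : ∀ p, p.Prime → p ∣ m' → p = P
    · exact stronglyDominated_zmod hall _ hψH x y hxy hkP
    · push Not at hall
      obtain ⟨l, hl, hlm, hlP⟩ := hall
      have hlQ := (hm'p l hl hlm).resolve_left hlP
      have hlq := hne l hl hlm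
      have hlodd : Odd l := hodd.of_dvd_nat (hlm.trans hdvd)
      refine (shortDominated_zmod (by omega) m' hm'p _ hψH x y hxy hkP).resolve_right ?_
      intro hlong
      rw [← hk] at hlong
      -- The odd primes l < q with Q ≤ l force q ≥ Q + 2. The total is then at least (Q + 1)k + (P -
      -- k)(Q - 1) = P(Q - 1) + 2k, which reaches 3P + Q because k ≥ 1; equality occurs at P = 3, Q
      -- = 5, k = 1.
      have hr : Q + 1 ≤ r := by
        obtain ⟨u, hu⟩ := hlodd
        obtain ⟨v, hv⟩ := hqodd
        omega
      have h1 : (Q + 1) * k ≤ r * k := Nat.mul_le_mul_right _ hr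
      obtain ⟨d, hd⟩ := Nat.exists_eq_add_of_lt hkP
      have hd' : P - k = d + 1 := by omega
      rw [hd'] at hlong
      obtain ⟨c, rfl⟩ := Nat.exists_eq_add_of_le hPQ
      have e : P + 2 + c - 1 = P + 1 + c := by omega
      rw [e] at hlong
      have h2 : (P + 3 + c) * k + (d + 1) * (P + 1 + c) < 4 * P + 2 + c := by
        have : P + 2 + c + 1 = P + 3 + c := by ring
        rw [this] at h1
        omega
      have h3 : (P + 3 + c) * k + (d + 1) * (P + 1 + c) = P * (P + 1 + c) + 2 * k := by
        rw [hd]; ring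
      rw [h3] at h2
      obtain ⟨b, rfl⟩ := Nat.exists_eq_add_of_le hP
      nlinarith [Nat.zero_le (b * c), Nat.zero_le (b * b)]
  · intro x hx hx0 hxle
    rw [sum_comp_addEquiv_symm] at hxle
    exact ih m' hlt (hodd.of_dvd_nat hdvd) hm'p _ hψH x hx hx0 (hxle.trans_lt hDlt)

/-! ### Coset decompositions and differences of prime order -/

section coset

variable {G : Type*} [AddCommGroup G]

open Classical in
/-- The indicator function of the coset `c.1 + ⟨c.2⟩`. -/
noncomputable def cosetIndicator (c : G × G) (g : G) : ℕ :=
  if g - c.1 ∈ AddSubgroup.zmultiples c.2 then 1 else 0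

lemma sum_cosetIndicator [Fintype G] (c : G × G) :
    ∑ g, cosetIndicator c g = addOrderOf c.2 := by
  classical
  have : ∑ g, cosetIndicator c g =
      ∑ g, if g ∈ AddSubgroup.zmultiples c.2 then 1 else 0 := by
    rw [← Equiv.sum_comp (Equiv.addRight c.1)]
    simp [cosetIndicator]
  rw [this, ← Finset.card_filter, ← Nat.card_zmultiples, Nat.card_eq_fintype_card,
    Fintype.card_subtype]

lemma charSum_cosetIndicator [Fintype G] {ψ : AddChar G ℂ} (hψ : Function.Injective ψ)
    (c : G × G) (hc : c.2 ≠ 0) : charSum ψ (cosetIndicator c) = 0 := by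
  have h1 : charSum ψ (cosetIndicator c) = ψ c.2 * charSum ψ (cosetIndicator c) := by
    conv_lhs => rw [charSum, ← Equiv.sum_comp (Equiv.addRight c.2)]
    rw [charSum, Finset.mul_sum]
    refine Finset.sum_congr rfl fun g _ => ?_
    have : cosetIndicator c (g + c.2) = cosetIndicator c g := by
      have hiff : g + c.2 - c.1 ∈ AddSubgroup.zmultiples c.2 ↔
          g - c.1 ∈ AddSubgroup.zmultiples c.2 := by
        rw [add_sub_right_comm]
        exact AddSubgroup.add_mem_cancel_right _ (AddSubgroup.mem_zmultiples _)
      simp only [cosetIndicator, hiff]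
    simp only [Equiv.coe_addRight, this, AddChar.map_add_eq_mul]
    ring
  have h2 : ψ c.2 ≠ 1 := by
    rw [← AddChar.map_zero_eq_one ψ]
    exact fun h => hc (hψ h)
  have h3 : (1 - ψ c.2) * charSum ψ (cosetIndicator c) = 0 := by linear_combination h1
  exact (mul_eq_zero.1 h3).resolve_left (sub_ne_zero.2 h2.symm)

/-- If every short vanishing relation contains a coset, short vanishing relations are sums of
cosets. -/
theorem exists_coset_decomposition [Fintype G] {ψ : AddChar G ℂ} (hψ : Function.Injective ψ)
    {B : ℕ} (hB : ∀ D : G → ℕ, charSum ψ D = 0 → 0 < ∑ g, D g → ∑ g, D g < B →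
      ContainsPrimeCoset D) (D : G → ℕ) (hD : charSum ψ D = 0) (hlt : ∑ g, D g < B) :
    ∃ L : Multiset (G × G), (∀ c ∈ L, (addOrderOf c.2).Prime) ∧
      ∀ g, D g = (L.map (fun c => cosetIndicator c g)).sum := by
  classical
  induction hN : ∑ g, D g using Nat.strong_induction_on generalizing D with
  | _ N ih =>
  subst hN
  by_cases h0 : ∑ g, D g = 0
  · refine ⟨0, by simp, fun g => ?_⟩
    simpa using (Finset.sum_eq_zero_iff.1 h0) g (mem_univ g)
  · obtain ⟨g₀, t, ht, hk⟩ := hB D hD (Nat.pos_of_ne_zero h0) hlt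
    have hle : ∀ g, cosetIndicator (g₀, t) g ≤ D g := by
      intro g
      by_cases hg : g - g₀ ∈ AddSubgroup.zmultiples t
      · obtain ⟨k, hk'⟩ := (mem_multiples_iff_mem_zmultiples (x := t)).2 hg
        have : D g = D (g₀ + k • t) := by
          congr 1
          simp only at hk'
          rw [hk']; abel
        rw [this]
        refine le_trans ?_ (hk k)
        rw [cosetIndicator, if_pos hg]
      · simp [cosetIndicator, hg]
    have hsplit : D = fun g => (D g - cosetIndicator (g₀, t) g) + cosetIndicator (g₀, t) g := by
      funext g; have := hle g; omega
    have ht0 : t ≠ 0 := by rintro rfl; simp at ht; exact Nat.not_prime_one ht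
    have hsum : ∑ g, D g = ∑ g, (D g - cosetIndicator (g₀, t) g) + addOrderOf t := by
      conv_lhs => rw [hsplit]
      rw [Finset.sum_add_distrib, sum_cosetIndicator]
    have hpos := ht.pos
    have hval : charSum ψ (fun g => D g - cosetIndicator (g₀, t) g) = 0 := by
      have := hD
      rw [hsplit, charSum_add, charSum_cosetIndicator hψ _ ht0, add_zero] at this
      exact this
    obtain ⟨L, hL, hLD⟩ := ih _ (by omega) _ hval (by omega) rfl
    refine ⟨(g₀, t) ::ₘ L, ?_, fun g => ?_⟩
    · intro c hc
      rcases Multiset.mem_cons.1 hc with rfl | hc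
      · exact ht
      · exact hL c hc
    · have h1 := hLD g
      have h2 := hle g
      rw [Multiset.map_cons, Multiset.sum_cons, ← h1]
      omega

lemma sum_eq_sum_addOrderOf [Fintype G] {D : G → ℕ} {L : Multiset (G × G)}
    (hD : ∀ g, D g = (L.map (fun c => cosetIndicator c g)).sum) :
    ∑ g, D g = (L.map (fun c => addOrderOf c.2)).sum := by
  simp_rw [hD]
  rw [Finset.sum_eq_multiset_sum, Multiset.sum_map_sum_map]
  congr 1
  refine Multiset.map_congr rfl fun c _ => ?_
  rw [← sum_cosetIndicator]; rfl

lemma prime_of_mem_zmultiples {s g : G} (hs : (addOrderOf s).Prime)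
    (hg : g ∈ AddSubgroup.zmultiples s) : g = 0 ∨ addOrderOf g = addOrderOf s := by
  have hd : addOrderOf g ∣ addOrderOf s := by
    obtain ⟨k, rfl⟩ := hg
    refine addOrderOf_dvd_of_nsmul_eq_zero ?_
    rw [smul_comm, addOrderOf_nsmul_eq_zero, smul_zero]
  rcases (Nat.dvd_prime hs).1 hd with h | h
  · exact Or.inl (AddMonoid.addOrderOf_eq_one_iff.1 h)
  · exact Or.inr h

/-- Doubling is invertible in odd order: with |G| = 2k + 1, the multiple (k + 1)·2g equals g. -/
lemma mem_of_two_nsmul_mem [Fintype G] (hG : Odd (Fintype.card G)) {K : AddSubgroup G} {g : G}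
    (hg : g + g ∈ K) : g ∈ K := by
  obtain ⟨k, hk⟩ := hG
  have h1 : (k + 1) • (g + g) = g := by
    have : (k + 1) • (g + g) = Fintype.card G • g + g := by
      rw [← two_nsmul, ← mul_nsmul, hk, ← succ_nsmul]
      congr 1
    rw [this, card_nsmul_eq_zero, zero_add]
  rw [← h1]
  exact K.nsmul_mem hg _

/-- In a symmetric union of two cosets of subgroups of distinct prime orders, in a group of odd
order, the cosets are subgroups. -/
lemma fst_mem_zmultiples_of_symm [Fintype G] (hG : Odd (Fintype.card G)) {c c' : G × G}
    (hc : (addOrderOf c.2).Prime) (hc' : (addOrderOf c'.2).Prime)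
    (hne : addOrderOf c.2 ≠ addOrderOf c'.2) {D : G → ℕ}
    (hD : ∀ g, D g = cosetIndicator c g + cosetIndicator c' g) (hsymm : ∀ g, D (-g) = D g) :
    c.1 ∈ AddSubgroup.zmultiples c.2 := by
  by_contra hcon
  -- If the negative of a point of the first coset lay in that coset again, then 2·c.1, hence c.1,
  -- would lie in ⟨c.2⟩. So the negated first coset lies inside the second, which forces c.2 into a
  -- subgroup of a different prime order.
  have key : ∀ s ∈ AddSubgroup.zmultiples c.2,
      -(c.1 + s) - c'.1 ∈ AddSubgroup.zmultiples c'.2 := by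
    intro s hs
    have h1 : 0 < D (-(c.1 + s)) := by
      rw [hsymm, hD]
      have : cosetIndicator c (c.1 + s) = 1 := by simp [cosetIndicator, hs]
      omega
    by_contra h2
    rw [hD] at h1
    have h3 : cosetIndicator c' (-(c.1 + s)) = 0 := if_neg h2
    have h4 : -(c.1 + s) - c.1 ∈ AddSubgroup.zmultiples c.2 := by
      by_contra h5
      have : cosetIndicator c (-(c.1 + s)) = 0 := if_neg h5
      omega
    refine hcon (mem_of_two_nsmul_mem hG ?_)
    have := AddSubgroup.neg_mem _ (AddSubgroup.add_mem _ h4 hs)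
    convert this using 1
    abel
  have h1 := key 0 (AddSubgroup.zero_mem _)
  have h2 := key c.2 (AddSubgroup.mem_zmultiples _)
  have h3 : c.2 ∈ AddSubgroup.zmultiples c'.2 := by
    have := AddSubgroup.sub_mem _ h1 h2
    convert this using 1
    abel
  rcases prime_of_mem_zmultiples hc' h3 with h | h
  · rw [h] at hc; simp at hc; exact Nat.not_prime_one hc
  · exact hne h

/-- A multiset of odd numbers, each equal to `P` or at least `Q > P`, whose sum is less than
`3P + Q` and is an even number prime to `P`, has exactly two elements. -/
lemma card_eq_two_of_sum_lt {L : Multiset ℕ} {P Q : ℕ} (hPQ : P ≤ Q)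
    (hL : ∀ p ∈ L, Odd p ∧ (p = P ∨ Q ≤ p)) (hlt : L.sum < 3 * P + Q) (heven : Even L.sum)
    (hP : ¬ P ∣ L.sum) : L.card = 2 := by
  have hpar : Even (L.sum) ↔ Even L.card := by
    clear hlt heven hP
    induction L using Multiset.induction_on with
    | empty => simp
    | cons a L ih =>
      rw [Multiset.sum_cons, Multiset.card_cons, Nat.even_add, Nat.even_add_one,
        ih fun p hp => hL p (Multiset.mem_cons_of_mem hp)]
      have := (hL a (Multiset.mem_cons_self _ _)).1
      rw [← Nat.not_even_iff_odd] at this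
      tauto
  have hev := hpar.1 heven
  -- Four terms that are not all P already sum to at least 3P + Q.
  have h4 : L.card < 4 := by
    by_contra! hcard
    by_cases hall : ∀ p ∈ L, p = P
    · exact hP (Multiset.dvd_sum fun p hp => by rw [hall p hp])
    · push Not at hall
      obtain ⟨p, hp, hpP⟩ := hall
      have hpQ := (hL p hp).2.resolve_left hpP
      obtain ⟨L', rfl⟩ := Multiset.exists_cons_of_mem hp
      have h1 : L'.card • P ≤ L'.sum := Multiset.card_nsmul_le_sum fun r hr => by
        rcases (hL r (Multiset.mem_cons_of_mem hr)).2 with h | h <;> omega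
      rw [Multiset.card_cons] at hcard
      rw [Multiset.sum_cons] at hlt
      have h2 : 3 * P ≤ L'.card * P := Nat.mul_le_mul_right _ (by omega)
      simp only [smul_eq_mul] at h1
      omega
  have h0 : L.card ≠ 0 := by
    intro h
    rw [Multiset.card_eq_zero] at h
    subst h
    simp at hP
  obtain ⟨k, hk⟩ := hev
  omega

/-- A short symmetric vanishing relation is the sum of two subgroups of distinct prime orders. -/
theorem eq_sum_two_subgroups [Fintype G] (hG : Odd (Fintype.card G)) {ψ : AddChar G ℂ}
    (hψ : Function.Injective ψ) {P Q n : ℕ} (hn : 1 ≤ n) (hP : 3 ≤ P) (hPQ : P ≤ Q)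
    (hord : ∀ t : G, (addOrderOf t).Prime → addOrderOf t = P ∨ Q ≤ addOrderOf t)
    (hPodd : Odd P)
    (hB : ∀ D : G → ℕ, charSum ψ D = 0 → 0 < ∑ g, D g → ∑ g, D g < 3 * P + Q →
      ContainsPrimeCoset D) (D : G → ℕ) (hD : charSum ψ D = 0) (hsum : ∑ g, D g = 2 ^ n)
    (hlt : 2 ^ n < 3 * P + Q) (hsymm : ∀ g, D (-g) = D g) :
    ∃ s t : G, (addOrderOf s).Prime ∧ (addOrderOf t).Prime ∧ addOrderOf s ≠ addOrderOf t ∧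
      0 < D s ∧ 0 < D t ∧ ∀ g, 0 < D g → g = 0 ∨ (addOrderOf g).Prime := by
  have hodd : ∀ t : G, Odd (addOrderOf t) := fun t => hG.of_dvd_nat addOrderOf_dvd_card
  have hndvd : ∀ k, k ≠ 1 → Odd k → ¬ k ∣ 2 ^ n := by
    intro k hk hko hkd
    obtain ⟨i, -, rfl⟩ := (Nat.dvd_prime_pow Nat.prime_two).1 hkd
    rcases Nat.eq_zero_or_pos i with rfl | hi
    · simp at hk
    · exact (Nat.not_even_iff_odd.2 hko) ((Nat.even_pow.2 ⟨even_two, hi.ne'⟩))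
  obtain ⟨L, hL, hLD⟩ := exists_coset_decomposition hψ hB D hD (hsum ▸ hlt)
  have hLsum := sum_eq_sum_addOrderOf hLD
  rw [hsum] at hLsum
  have hcard : (L.map (fun c => addOrderOf c.2)).card = 2 := by
    refine card_eq_two_of_sum_lt hPQ ?_ (hLsum ▸ hlt) ?_ ?_
    · intro p hp
      obtain ⟨c, hc, rfl⟩ := Multiset.mem_map.1 hp
      exact ⟨hodd _, hord _ (hL c hc)⟩
    · rw [← hLsum]; exact Nat.even_pow.2 ⟨even_two, by omega⟩
    · rw [← hLsum]; exact hndvd P (by omega) hPodd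
  rw [Multiset.card_map, Multiset.card_eq_two] at hcard
  obtain ⟨c, c', rfl⟩ := hcard
  have hc := hL c (by simp)
  have hc' := hL c' (by simp)
  have hD2 : ∀ g, D g = cosetIndicator c g + cosetIndicator c' g := by
    intro g; rw [hLD]; simp
  have hsum2 : 2 ^ n = addOrderOf c.2 + addOrderOf c'.2 := by rw [hLsum]; simp
  have hne : addOrderOf c.2 ≠ addOrderOf c'.2 := by
    intro h
    refine hndvd (addOrderOf c.2) hc.ne_one (hodd _) ?_
    rw [hsum2, ← h]
    exact dvd_add dvd_rfl dvd_rfl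
  have hmem := fst_mem_zmultiples_of_symm hG hc hc' hne hD2 hsymm
  have hmem' := fst_mem_zmultiples_of_symm hG hc' hc hne.symm
    (fun g => by rw [hD2, add_comm]) hsymm
  have hind : ∀ c : G × G, c.1 ∈ AddSubgroup.zmultiples c.2 → cosetIndicator c c.2 = 1 := by
    intro c h
    simp [cosetIndicator, AddSubgroup.sub_mem _ (AddSubgroup.mem_zmultiples c.2) h]
  have hpr : ∀ c : G × G, (addOrderOf c.2).Prime → c.1 ∈ AddSubgroup.zmultiples c.2 → ∀ g,
      cosetIndicator c g ≠ 0 → g = 0 ∨ (addOrderOf g).Prime := by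
    intro c hcp h g hg
    have h1 : g - c.1 ∈ AddSubgroup.zmultiples c.2 := by
      by_contra h2; simp [cosetIndicator, h2] at hg
    have h2 := AddSubgroup.add_mem _ h1 h
    rw [sub_add_cancel] at h2
    exact (prime_of_mem_zmultiples hcp h2).imp id (fun h => by rwa [h])
  refine ⟨c.2, c'.2, hc, hc', hne, ?_, ?_, fun g hg => ?_⟩
  · rw [hD2, hind c hmem]; omega
  · rw [hD2, hind c' hmem']; omega
  · rw [hD2] at hg
    by_cases h : cosetIndicator c g = 0
    · exact hpr c' hc' hmem' g (by omega)
    · exact hpr c hc hmem g h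

/-- If g and w had distinct prime orders, g + w would have their product as order, which is neither
1 nor prime. -/
lemma nsmul_eq_zero_of_add_prime {g w : G} (hg : g = 0 ∨ (addOrderOf g).Prime)
    (hw : (addOrderOf w).Prime) (hgw : g + w = 0 ∨ (addOrderOf (g + w)).Prime) :
    addOrderOf w • g = 0 := by
  rcases hg with rfl | hg
  · simp
  by_cases h : addOrderOf g = addOrderOf w
  · rw [← h, addOrderOf_nsmul_eq_zero]
  · have hcop := (Nat.coprime_primes hg hw).2 h
    have hmul := (AddCommute.all g w).addOrderOf_add_eq_mul_addOrderOf_of_coprime hcop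
    exfalso
    rcases hgw with h0 | h0
    · rw [h0, addOrderOf_zero] at hmul
      exact hg.ne_one (Nat.eq_one_of_mul_eq_one_right hmul.symm)
    · rw [hmul] at h0
      exact Nat.not_prime_mul hg.ne_one hw.ne_one h0

/-- If all differences of values of `f` have order one or a prime, then the differences in a
fixed direction cannot have two distinct prime orders. -/
lemma false_of_prime_order_differences {V : Type*} {f : V → G}
    (hf : ∀ x y, f y - f x = 0 ∨ (addOrderOf (f y - f x)).Prime) {x x' y y' : V}
    (hx : (addOrderOf (f x' - f x)).Prime) (hy : (addOrderOf (f y' - f y)).Prime)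
    (hne : addOrderOf (f x' - f x) ≠ addOrderOf (f y' - f y)) : False := by
  have h1 := nsmul_eq_zero_of_add_prime (hf x y) hy (by
    rw [show f y - f x + (f y' - f y) = f y' - f x by abel]; exact hf _ _)
  have hx' : addOrderOf (f x - f x') = addOrderOf (f x' - f x) := by
    rw [← addOrderOf_neg, neg_sub]
  have h2 := nsmul_eq_zero_of_add_prime (hf x y) (hx'.symm ▸ hx) (by
    rw [show f y - f x + (f x - f x') = f y - f x' by abel]; exact hf _ _)
  rw [hx'] at h2
  have h3 : f y - f x = 0 := by
    rw [← AddMonoid.addOrderOf_eq_one_iff]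
    exact Nat.eq_one_of_dvd_coprimes ((Nat.coprime_primes hx hy).2 hne)
      (addOrderOf_dvd_of_nsmul_eq_zero h2) (addOrderOf_dvd_of_nsmul_eq_zero h1)
  have hyx : f y = f x := sub_eq_zero.1 h3
  have h4 := nsmul_eq_zero_of_add_prime (Or.inr hy) (hx'.symm ▸ hx) (by
    rw [show f y' - f y + (f x - f x') = f y' - f x' by rw [hyx]; abel]; exact hf _ _)
  rw [hx'] at h4
  have h5 := addOrderOf_dvd_of_nsmul_eq_zero h4
  exact hne ((Nat.prime_dvd_prime_iff_eq hy hx).1 h5).symm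

end coset

/-! ### Bentness as vanishing autocorrelation -/

lemma gbfZeta_pow_val {m : ℕ} [NeZero m] (z : ZMod m) : gbfZeta m ^ z.val = ZMod.stdAddChar z := by
  have h := ZMod.stdAddChar_coe (N := m) (z.val : ℤ)
  have hz : ((z.val : ℤ) : ZMod m) = z := by simp
  rw [hz] at h
  rw [h, gbfZeta, ← Complex.exp_nat_mul]
  congr 1
  push_cast
  ring

lemma neg_one_pow_val (z : ZMod 2) : (-1 : ℂ) ^ z.val = ZMod.stdAddChar z := by
  rw [← gbfZeta_pow_val]
  congr 1
  rw [gbfZeta, ← Complex.exp_pi_mul_I]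
  congr 1
  push_cast
  ring

section autocorrelation

variable {n : ℕ}

/-- The autocorrelation of `ψ ∘ f` in the direction `v`. -/
noncomputable def autocorrelation {G : Type*} [AddCommGroup G] (ψ : AddChar G ℂ)
    (f : (Fin n → ZMod 2) → G) (v : Fin n → ZMod 2) : ℂ :=
  ∑ x, ψ (f (x + v) - f x)

lemma autocorrelation_zero {G : Type*} [AddCommGroup G] (ψ : AddChar G ℂ)
    (f : (Fin n → ZMod 2) → G) : autocorrelation ψ f 0 = 2 ^ n := by
  simp [autocorrelation]

lemma add_self_zmod_two (v : Fin n → ZMod 2) : v + v = 0 := by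
  funext i; exact CharTwo.add_self_eq_zero (v i)

lemma neg_zmod_two (v : Fin n → ZMod 2) : -v = v :=
  neg_eq_of_add_eq_zero_left (add_self_zmod_two v)

lemma sum_sign_dotProduct (c : Fin n → ZMod 2) :
    ∑ y : Fin n → ZMod 2, (ZMod.stdAddChar (y ⬝ᵥ c) : ℂ) = if c = 0 then 2 ^ n else 0 := by
  split_ifs with h
  · simp [h]
  · obtain ⟨i, hi⟩ := Function.ne_iff.1 h
    have hi : c i = 1 := by
      have : ∀ z : ZMod 2, z ≠ 0 → z = 1 := by decide
      exact this _ hi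
    -- Translating y by a basis vector where c has coordinate 1 changes the sign of the sum.
    have h1 := Equiv.sum_comp (Equiv.addRight (Pi.single i 1 : Fin n → ZMod 2))
      (fun y : Fin n → ZMod 2 => (ZMod.stdAddChar (y ⬝ᵥ c) : ℂ))
    have h2 : (ZMod.stdAddChar (1 : ZMod 2) : ℂ) = -1 := by
      rw [← neg_one_pow_val, ZMod.val_one, pow_one]
    simp only [Equiv.coe_addRight, add_dotProduct, single_dotProduct, hi,
      AddChar.map_add_eq_mul, h2, mul_neg, mul_one, Finset.sum_neg_distrib] at h1
    linear_combination (-1 / 2 : ℂ) * h1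

/-- Expand F times its conjugate and index the second variable by its offset v from x; signs are
real, so only (-1)^(y·v) survives. -/
lemma norm_gbfTransform_sq {m : ℕ} [NeZero m] (f : (Fin n → ZMod 2) → ZMod m)
    (y : Fin n → ZMod 2) :
    ((‖gbfTransform m n f y‖ ^ 2 : ℝ) : ℂ) =
      ∑ v, ZMod.stdAddChar (y ⬝ᵥ v) * autocorrelation ZMod.stdAddChar f v := by
  have hF : gbfTransform m n f y =
      ∑ x, ZMod.stdAddChar (f x) * ZMod.stdAddChar (y ⬝ᵥ x) := by
    simp only [gbfTransform, gbfZeta_pow_val, neg_one_pow_val]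
  have hR : ∑ v, ZMod.stdAddChar (y ⬝ᵥ v) * autocorrelation ZMod.stdAddChar f v =
      ∑ x, ∑ v, ZMod.stdAddChar (y ⬝ᵥ v) * ZMod.stdAddChar (f (x + v) - f x) := by
    simp only [autocorrelation, Finset.mul_sum]
    rw [Finset.sum_comm]
  rw [hR, ← Complex.normSq_eq_norm_sq, ← Complex.mul_conj, hF, map_sum, Finset.sum_mul_sum,
    Finset.sum_comm]
  refine Finset.sum_congr rfl fun x _ => ?_
  rw [← Equiv.sum_comp (Equiv.addLeft x)]
  refine Finset.sum_congr rfl fun v _ => ?_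
  have h1 : (ZMod.stdAddChar (-(y ⬝ᵥ x)) : ℂ) = ZMod.stdAddChar (y ⬝ᵥ x) := by
    congr 1; generalize y ⬝ᵥ x = z; revert z; decide
  have h2 : (ZMod.stdAddChar (y ⬝ᵥ x) : ℂ) * ZMod.stdAddChar (y ⬝ᵥ x) = 1 := by
    nth_rewrite 1 [← h1]
    rw [← AddChar.map_add_eq_mul, neg_add_cancel, AddChar.map_zero_eq_one]
  simp only [Equiv.coe_addLeft, map_mul, ← AddChar.map_neg_eq_conj, h1, dotProduct_add,
    AddChar.map_add_eq_mul, sub_eq_add_neg]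
  linear_combination (ZMod.stdAddChar (f (x + v)) * ZMod.stdAddChar (-f x) *
    ZMod.stdAddChar (y ⬝ᵥ v) : ℂ) * h2

theorem isGBF_iff_autocorrelation {m : ℕ} [NeZero m] (f : (Fin n → ZMod 2) → ZMod m) :
    IsGBF m n f ↔ ∀ v, v ≠ 0 → autocorrelation ZMod.stdAddChar f v = 0 := by
  constructor
  · intro h w hw
    have h1 : ∀ y, ∑ v, ZMod.stdAddChar (y ⬝ᵥ v) * autocorrelation ZMod.stdAddChar f v =
        (2 : ℂ) ^ n := by
      intro y
      rw [← norm_gbfTransform_sq, h y]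
      push_cast; rfl
    have h2 : ∑ y : Fin n → ZMod 2, ZMod.stdAddChar (y ⬝ᵥ w) *
        ∑ v, ZMod.stdAddChar (y ⬝ᵥ v) * autocorrelation ZMod.stdAddChar f v = 0 := by
      simp only [h1]
      rw [← Finset.sum_mul, sum_sign_dotProduct, if_neg hw, zero_mul]
    simp only [Finset.mul_sum] at h2
    rw [Finset.sum_comm] at h2
    have h3 : ∀ v : Fin n → ZMod 2, ∑ y : Fin n → ZMod 2, ZMod.stdAddChar (y ⬝ᵥ w) *
        (ZMod.stdAddChar (y ⬝ᵥ v) * autocorrelation ZMod.stdAddChar f v) =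
        if v = w then (2 : ℂ) ^ n * autocorrelation ZMod.stdAddChar f w else 0 := by
      intro v
      have : ∀ y : Fin n → ZMod 2, ZMod.stdAddChar (y ⬝ᵥ w) *
        (ZMod.stdAddChar (y ⬝ᵥ v) * autocorrelation ZMod.stdAddChar f v) =
          ZMod.stdAddChar (y ⬝ᵥ (w + v)) * autocorrelation ZMod.stdAddChar f v := by
        intro y
        rw [dotProduct_add, AddChar.map_add_eq_mul, mul_assoc]
      simp only [this]
      rw [← Finset.sum_mul, sum_sign_dotProduct]
      by_cases hvw : v = w
      · rw [if_pos hvw, hvw, if_pos (add_self_zmod_two w)]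
      · rw [if_neg hvw, if_neg, zero_mul]
        intro h0
        apply hvw
        rw [eq_neg_of_add_eq_zero_right h0, neg_zmod_two]
    simp only [h3, Finset.sum_ite_eq', Finset.mem_univ, if_true] at h2
    exact (mul_eq_zero.1 h2).resolve_left (pow_ne_zero _ two_ne_zero)
  · intro h y
    have h1 := norm_gbfTransform_sq f y
    rw [Finset.sum_eq_single 0 (fun v _ hv => by rw [h v hv, mul_zero]) (by simp),
      autocorrelation_zero] at h1
    simp only [dotProduct_zero, AddChar.map_zero_eq_one, one_mul] at h1
    exact_mod_cast h1

end autocorrelation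

/-! ### Difference counts -/

section differences

variable {n : ℕ} {G : Type*} [AddCommGroup G]

open Classical in
/-- The number of `x` with `f (x + v) - f x = g`. -/
noncomputable def diffCount (f : (Fin n → ZMod 2) → G) (v : Fin n → ZMod 2) (g : G) : ℕ :=
  #{x | f (x + v) - f x = g}

variable (f : (Fin n → ZMod 2) → G) (v : Fin n → ZMod 2)

lemma sum_diffCount_mul [Fintype G] (w : G → ℂ) :
    ∑ g, (diffCount f v g : ℂ) * w g = ∑ x, w (f (x + v) - f x) := by
  classical
  have : ∀ g, (diffCount f v g : ℂ) * w g = ∑ x, if f (x + v) - f x = g then w g else 0 := by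
    intro g
    rw [← Finset.sum_filter, Finset.sum_const, nsmul_eq_mul]
    rfl
  simp only [this]
  rw [Finset.sum_comm]
  simp

lemma charSum_diffCount [Fintype G] (ψ : AddChar G ℂ) :
    charSum ψ (diffCount f v) = autocorrelation ψ f v :=
  sum_diffCount_mul f v ψ

lemma sum_diffCount [Fintype G] : ∑ g, diffCount f v g = 2 ^ n := by
  have := sum_diffCount_mul f v (fun _ => 1)
  simp only [mul_one, Finset.sum_const, Finset.card_univ, Fintype.card_pi, ZMod.card,
    Finset.prod_const, Fintype.card_fin] at this
  simp only [nsmul_eq_mul, mul_one] at this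
  exact_mod_cast this

lemma diffCount_neg (g : G) : diffCount f v (-g) = diffCount f v g := by
  classical
  refine Finset.card_bij' (fun x _ => x + v) (fun x _ => x + v) ?_ ?_ ?_ ?_
  · intro x hx
    simp only [mem_filter, mem_univ, true_and] at hx ⊢
    rw [add_assoc, add_self_zmod_two, add_zero, ← neg_sub, hx, neg_neg]
  · intro x hx
    simp only [mem_filter, mem_univ, true_and] at hx ⊢
    rw [add_assoc, add_self_zmod_two, add_zero, ← neg_sub, hx]
  · intro x _
    rw [add_assoc, add_self_zmod_two, add_zero]
  · intro x _
    rw [add_assoc, add_self_zmod_two, add_zero]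

lemma diffCount_pos_iff (g : G) : 0 < diffCount f v g ↔ ∃ x, f (x + v) - f x = g := by
  classical
  rw [diffCount, Finset.card_pos]
  simp [Finset.Nonempty]

lemma diffCount_zero_even (hv : v ≠ 0) : Even (diffCount f v 0) := by
  classical
  rw [← ZMod.natCast_eq_zero_iff_even, diffCount, Finset.card_eq_sum_ones, Nat.cast_sum]
  refine Finset.sum_involution (fun x _ => x + v) ?_ ?_ ?_ ?_
  · intro _ _; decide
  · intro x _ _ h
    exact hv (by simpa using h)
  · intro x hx
    simp only [mem_filter, mem_univ, true_and] at hx ⊢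
    rw [add_assoc, add_self_zmod_two, add_zero, ← neg_sub, hx, neg_zero]
  · intro x _
    rw [add_assoc, add_self_zmod_two, add_zero]

lemma sum_diffCount_slice {H C : Type*} [AddCommGroup H] [Fintype H] [AddCommGroup C]
    (f : (Fin n → ZMod 2) → H × C) (v : Fin n → ZMod 2) (c : C) :
    ∑ h, diffCount f v (h, c) = diffCount (fun x => (f x).2) v c := by
  classical
  simp only [diffCount]
  rw [Finset.card_eq_sum_card_fiberwise (f := fun x => (f (x + v) - f x).1) (t := univ) (by simp)]
  refine Finset.sum_congr rfl fun h _ => ?_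
  rw [Finset.filter_filter]
  congr 1
  ext x
  simp only [mem_filter, mem_univ, true_and, Prod.ext_iff, Prod.fst_sub, Prod.snd_sub]
  tauto

end differences

/-! ### Removing a prime power component -/

/-- A short relation expressing a root of unity by others of small odd order is trivial. -/
lemma sum_eq_one_of_charSum_eq {m P : ℕ} [NeZero m] (hP : 3 ≤ P) (hodd : Odd m)
    (hPodd : Odd P) (hm : ∀ p, p.Prime → p ∣ m → P ≤ p) (ψ : AddChar (ZMod m) ℂ)
    (hψ : Function.Injective ψ) {x y : ZMod m → ℕ} (hx : ∑ g, x g = 1)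
    (hxy : charSum ψ x = charSum ψ y) (hy : ∑ g, y g < P) : ∑ g, y g = 1 := by
  have hm' : ∀ p, p.Prime → p ∣ m → p = P ∨ P + 2 ≤ p := by
    intro p hp hpm
    obtain ⟨a, ha⟩ := hodd.of_dvd_nat hpm
    obtain ⟨b, hb⟩ := hPodd
    have := hm p hp hpm
    omega
  -- The value Q = P + 2 is available by parity. The long alternative would give (P - 1)(P + 1) ≤
  -- |y| < P; in the other, y - x is a vanishing sum with fewer than P terms, too few for a prime
  -- coset.
  rcases shortDominated_zmod (Nat.le_add_right P 2) m hm' ψ hψ x y hxy (by omega) with h | h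
  · have hsplit : y = fun g => x g + (y g - x g) := by
      funext g; have := h g; omega
    have hsum : ∑ g, y g = 1 + ∑ g, (y g - x g) := by
      conv_lhs => rw [hsplit]
      rw [Finset.sum_add_distrib, hx]
    have hval : charSum ψ (fun g => y g - x g) = 0 := by
      rw [hsplit, charSum_add] at hxy
      linear_combination -hxy
    rcases Nat.eq_zero_or_pos (∑ g, (y g - x g)) with h0 | h0
    · omega
    · obtain ⟨g, t, ht, hk⟩ := containsPrimeCoset_of_charSum_eq_zero hP le_rfl m hodd hm' ψ hψ _
        hval h0 (by omega)
      have h1 := hm _ ht (by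
        have := addOrderOf_dvd_card (x := t)
        rwa [ZMod.card] at this)
      have h2 : ∑ i ∈ range (addOrderOf t), 1 ≤
          ∑ i ∈ range (addOrderOf t), (y (g + i • t) - x (g + i • t)) :=
        Finset.sum_le_sum fun i _ => hk i
      classical
      have h3 : ∑ i ∈ range (addOrderOf t), (y (g + i • t) - x (g + i • t)) ≤
          ∑ g, (y g - x g) := by
        rw [← Finset.sum_image (f := fun c => y c - x c) (g := fun i : ℕ => g + i • t)
          (add_nsmul_injOn g rfl)]
        exact Finset.sum_le_sum_of_subset (Finset.subset_univ _)
      rw [Finset.sum_const, card_range, smul_eq_mul, mul_one] at h2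
      omega
  · rw [hx] at h
    have e : P + 2 - 1 = P + 1 := by omega
    rw [e] at h
    have h2 : 1 * (P + 1) ≤ (P - 1) * (P + 1) := Nat.mul_le_mul_right _ (by omega)
    omega

section reduction

variable {n : ℕ} {H C : Type*} [AddCommGroup H] [Fintype H] [AddCommGroup C] [Fintype C]

/-- If `2ⁿ < P + q`, all slices of the difference counts of a function with vanishing
autocorrelation along the subgroup of order `q` vanish. -/
theorem charSum_slice_diffCount_eq_zero {ψ : AddChar (H × C) ℂ} {t : C} {P q : ℕ}
    (hs : SliceInvariant ψ t) (ht : addOrderOf t = q) (hq : 1 < q) (hC : Odd (Fintype.card C))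
    (hPq : P ≤ q) (hPodd : Odd P) (hlt : 2 ^ n < P + q)
    (hH : ∀ x y : H → ℕ, ∑ h, x h = 1 →
      charSum ψ.fstRestrict x = charSum ψ.fstRestrict y → ∑ h, y h < P → ∑ h, y h = 1)
    (f : (Fin n → ZMod 2) → H × C) (v : Fin n → ZMod 2) (hv : v ≠ 0)
    (hf : autocorrelation ψ f v = 0) (j : C) :
    charSum ψ.fstRestrict (fun h => diffCount f v (h, j)) = 0 := by
  classical
  by_contra hj
  have hD : charSum ψ (diffCount f v) = 0 := by rw [charSum_diffCount, hf]
  set S : C → ℕ := fun c => ∑ h, diffCount f v (h, c) with hS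
  have hSd : ∀ c, S c = diffCount (fun x => (f x).2) v c := sum_diffCount_slice f v
  have hStot : ∑ c, S c = 2 ^ n := by simp_rw [hSd]; exact sum_diffCount _ v
  have hSneg : ∀ c, S (-c) = S c := fun c => by rw [hSd, hSd, diffCount_neg]
  have hpos : ∀ k, charSum ψ.fstRestrict (fun h => diffCount f v (h, k)) ≠ 0 → ∀ i : ℕ,
      1 ≤ S (k + i • t) := by
    intro k hk i
    refine Nat.one_le_iff_ne_zero.2 fun h => hk ?_
    rw [hs.charSum_eq hD k i]
    exact charSum_eq_zero_of_sum_eq_zero _ h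
  -- Otherwise j + ⟨t⟩ and its negative are disjoint, since the order is odd, and both consist of
  -- nonempty slices, so 2q ≤ 2ⁿ < P + q ≤ 2q.
  have hjT : j ∈ AddSubgroup.zmultiples t := by
    refine mem_of_two_nsmul_mem hC ?_
    by_contra hcon
    set A := (range q).image (fun i : ℕ => j + i • t) with hA
    set B := A.image (fun c => -c) with hBdef
    have hcA : #A = q := by
      rw [hA, Finset.card_image_of_injOn (add_nsmul_injOn j ht), card_range]
    have hcB : #B = q := by rw [hBdef, Finset.card_image_of_injective _ neg_injective, hcA]
    have hdisj : Disjoint A B := by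
      rw [Finset.disjoint_left]
      intro c hcA hcB
      obtain ⟨d, hdA, rfl⟩ := mem_image.1 hcB
      obtain ⟨i, -, hi⟩ := mem_image.1 hdA
      obtain ⟨k, -, hk⟩ := mem_image.1 hcA
      apply hcon
      have h1 : j + j = -((i + k) • t) := by
        rw [← hi] at hk
        rw [add_smul]
        have : j + j + (i • t + k • t) = 0 := by
          calc j + j + (i • t + k • t) = (j + k • t) + (j + i • t) := by abel
            _ = 0 := by rw [hk]; abel
        exact eq_neg_of_add_eq_zero_left this
      rw [h1]
      exact AddSubgroup.neg_mem _ (AddSubgroup.nsmul_mem _ (AddSubgroup.mem_zmultiples t) _)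
    have h1 : #(A ∪ B) ≤ ∑ c ∈ A ∪ B, S c := by
      rw [Finset.card_eq_sum_ones]
      refine Finset.sum_le_sum fun c hc => ?_
      have hSA : ∀ c ∈ A, 1 ≤ S c := by
        intro c hc
        obtain ⟨i, -, rfl⟩ := mem_image.1 hc
        exact hpos j hj i
      rcases mem_union.1 hc with h | h
      · exact hSA c h
      · obtain ⟨d, hd, rfl⟩ := mem_image.1 h
        rw [hSneg]; exact hSA d hd
    have h2 : ∑ c ∈ A ∪ B, S c ≤ 2 ^ n := by
      rw [← hStot]; exact Finset.sum_le_sum_of_subset (Finset.subset_univ _)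
    rw [Finset.card_union_of_disjoint hdisj, hcA, hcB] at h1
    omega
  obtain ⟨i₀, hi₀⟩ := (mem_multiples_iff_mem_zmultiples (x := t)).2
    (AddSubgroup.neg_mem _ hjT)
  have h0 : charSum ψ.fstRestrict (fun h => diffCount f v (h, 0)) ≠ 0 := by
    rw [hs.charSum_eq hD j i₀] at hj
    simp only at hi₀
    rwa [hi₀, add_neg_cancel] at hj
  have hS1 : ∀ i : ℕ, 1 ≤ S (i • t) := fun i => by simpa using hpos 0 h0 i
  have hle : ∑ i ∈ range q, S (i • t) ≤ 2 ^ n := by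
    have := sum_slices_le (diffCount f v) 0 ht
    rw [sum_diffCount] at this
    simpa [S] using this
  obtain ⟨r, rfl⟩ := Nat.exists_eq_add_of_lt hq
  have hev : Even (S 0) := by
    rw [hSd]; exact diffCount_zero_even _ v hv
  have hS0 : 1 ≤ S 0 := by simpa using hS1 0
  -- All q slices are nonempty and their total is below 2q, so one of them is a single point.
  have hex : ∃ i ∈ range (1 + r + 1), S (i • t) = 1 := by
    by_contra! hne
    have : ∑ i ∈ range (1 + r + 1), 2 ≤ ∑ i ∈ range (1 + r + 1), S (i • t) :=
      Finset.sum_le_sum fun i hi => by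
        have := hS1 i
        have := hne i hi
        omega
    simp at this
    omega
  obtain ⟨i, -, hi⟩ := hex
  -- The other q - 1 slices leave S 0 ≤ P, and parity excludes equality. The singleton slice then
  -- forces S 0 = 1, contradicting evenness.
  have hS0P : S 0 < P := by
    rw [Finset.sum_range_succ'] at hle
    have : ∑ i ∈ range (1 + r), 1 ≤ ∑ i ∈ range (1 + r), S ((i + 1) • t) :=
      Finset.sum_le_sum fun i _ => hS1 _
    simp only [Finset.sum_const, card_range, smul_eq_mul, mul_one, zero_smul] at this hle
    obtain ⟨a, ha⟩ := hev
    obtain ⟨b, hb⟩ := hPodd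
    omega
  have h1 := hH (fun h => diffCount f v (h, i • t)) (fun h => diffCount f v (h, 0)) hi
    (by have := hs.charSum_eq hD 0 i; rw [zero_add] at this; exact this.symm) hS0P
  obtain ⟨a, ha⟩ := hev
  have h2 : S 0 = 1 := h1
  omega

lemma autocorrelation_fst {ψ : AddChar (H × C) ℂ} (f : (Fin n → ZMod 2) → H × C)
    (v : Fin n → ZMod 2)
    (h : ∀ j, charSum ψ.fstRestrict (fun h => diffCount f v (h, j)) = 0) :
    autocorrelation ψ.fstRestrict (fun x => (f x).1) v = 0 := by
  have h1 := sum_diffCount_mul f v (fun g => ψ.fstRestrict g.1)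
  rw [Fintype.sum_prod_type_right] at h1
  exact h1.symm.trans (Finset.sum_eq_zero fun j _ => h j)

end reduction

/-- A prime power component `qᵃ⁺¹` of `m` can be removed when `2ⁿ < P + q`. -/
theorem exists_isGBF_of_mul_primePow {n m' q a P : ℕ} (hm' : m' ≠ 0) (hodd : Odd m')
    (hq : q.Prime) (hqodd : Odd q) (hcop : q.Coprime m') (hP : 3 ≤ P) (hPodd : Odd P)
    (hPm : ∀ p, p.Prime → p ∣ m' → P ≤ p) (hPq : P ≤ q) (hlt : 2 ^ n < P + q)
    (h : ∃ f, IsGBF (m' * q ^ (a + 1)) n f) : ∃ f, IsGBF m' n f := by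
  obtain ⟨f, hf⟩ := h
  have : NeZero m' := ⟨hm'⟩
  have : NeZero (q ^ (a + 1)) := ⟨pow_ne_zero _ hq.ne_zero⟩
  have hcop' : m'.Coprime (q ^ (a + 1)) := (Nat.Coprime.pow_left _ hcop).symm
  rw [isGBF_iff_autocorrelation] at hf
  set e := zmodSplit hcop' with he
  set ψ := (ZMod.stdAddChar (N := m' * q ^ (a + 1))).compAddMonoidHom
    (e.symm : ZMod m' × ZMod (q ^ (a + 1)) →+ ZMod (m' * q ^ (a + 1))) with hψdef
  have hψ : Function.Injective ψ :=
    compAddMonoidHom_symm_injective e ZMod.injective_stdAddChar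
  have hψH := AddChar.fstRestrict_injective hψ
  have hs := sliceInvariant_zmod hq hcop ψ hψ
  have hauto : ∀ v, autocorrelation ψ (fun x => e (f x)) v =
      autocorrelation ZMod.stdAddChar f v := by
    intro v
    refine Finset.sum_congr rfl fun x _ => ?_
    rw [← map_sub]
    change ZMod.stdAddChar (e.symm (e _)) = _
    rw [e.symm_apply_apply]
  obtain ⟨u, hu⟩ := AddChar.exists_eq_stdAddChar_mul ψ.fstRestrict
  -- The multiplier u accounts for the restricted character on ℤ/m' being h ↦ `stdAddChar` (u h)
  -- rather than the standard one.
  refine ⟨fun x => u * (e (f x)).1, (isGBF_iff_autocorrelation _).2 fun v hv => ?_⟩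
  have h1 := autocorrelation_fst (ψ := ψ) (fun x => e (f x)) v
    (charSum_slice_diffCount_eq_zero hs (addOrderOf_pow_in_zmod hq) hq.one_lt
      (by rw [ZMod.card]; exact hqodd.pow) hPq hPodd hlt
      (fun x y hx hxy hy => sum_eq_one_of_charSum_eq hP hodd hPodd hPm _ hψH hx hxy hy)
      _ v hv (by rw [hauto, hf v hv]))
  rw [← h1]
  refine Finset.sum_congr rfl fun x _ => ?_
  rw [hu, mul_sub]

/-! ### Nonexistence results -/

/-- There is no generalized bent function into a group of odd prime power order. -/
theorem not_exists_isGBF_primePow {n q a : ℕ} (hn : 1 ≤ n) (hq : q.Prime) (hqodd : Odd q) :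
    ¬ ∃ f, IsGBF (q ^ (a + 1)) n f := by
  rintro ⟨f, hf⟩
  have hne : NeZero (q ^ (a + 1)) := ⟨pow_ne_zero _ hq.ne_zero⟩
  rw [isGBF_iff_autocorrelation] at hf
  obtain ⟨v, hv⟩ : ∃ v : Fin n → ZMod 2, v ≠ 0 :=
    ⟨fun _ => 1, fun h => one_ne_zero (congrFun h ⟨0, hn⟩)⟩
  have h0 := hf v hv
  have hprim := Complex.isPrimitiveRoot_exp (q ^ (a + 1)) hne.ne
  have hpos := Nat.pos_of_ne_zero hne.ne
  let F : Polynomial ℤ := ∑ x, Polynomial.X ^ (f (x + v) - f x).val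
  have hF : Polynomial.aeval (Complex.exp (2 * Real.pi * Complex.I / (q ^ (a + 1) : ℕ))) F = 0 := by
    rw [← h0]
    simp only [F, map_sum, map_pow, Polynomial.aeval_X, autocorrelation, ← gbfZeta_pow_val]
    rfl
  have hdvd : Polynomial.cyclotomic (q ^ (a + 1)) ℤ ∣ F := by
    rw [Polynomial.cyclotomic_eq_minpoly hprim hpos]
    exact minpoly.isIntegrallyClosed_dvd (hprim.isIntegral hpos) hF
  -- At 1 the cyclotomic polynomial of qᵃ⁺¹ takes the value q, and F, a sum of 2ⁿ monomials, takes
  -- the value 2ⁿ.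
  have h1 := Polynomial.eval_dvd (x := 1) hdvd
  have : Fact q.Prime := ⟨hq⟩
  rw [Polynomial.eval_one_cyclotomic_prime_pow] at h1
  have h2 : Polynomial.eval 1 F = (2 ^ n : ℕ) := by
    simp [F, Polynomial.eval_finsetSum]
  rw [h2, Int.natCast_dvd_natCast] at h1
  have h3 := hq.dvd_of_dvd_pow h1
  rw [Nat.prime_dvd_prime_iff_eq hq Nat.prime_two] at h3
  subst h3
  exact absurd hqodd (by decide)

/-- There is no generalized bent function when `2ⁿ < 3P + Q`, where every prime factor of the odd
number `m` is `P` or at least `Q`. -/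
theorem not_exists_isGBF_of_lt {n m P Q : ℕ} (hn : 1 ≤ n) (hm0 : m ≠ 0) (hodd : Odd m)
    (hP : 3 ≤ P) (hPodd : Odd P) (hPQ : P + 2 ≤ Q)
    (hm : ∀ p, p.Prime → p ∣ m → p = P ∨ Q ≤ p) (hlt : 2 ^ n < 3 * P + Q) :
    ¬ ∃ f, IsGBF m n f := by
  rintro ⟨f, hf⟩
  have : NeZero m := ⟨hm0⟩
  rw [isGBF_iff_autocorrelation] at hf
  have hord : ∀ t : ZMod m, (addOrderOf t).Prime → addOrderOf t = P ∨ Q ≤ addOrderOf t := by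
    intro t ht
    refine hm _ ht ?_
    have := addOrderOf_dvd_card (x := t)
    rwa [ZMod.card] at this
  have hinj := ZMod.injective_stdAddChar (N := m)
  have key := fun v (hv : v ≠ 0) => eq_sum_two_subgroups (G := ZMod m) (by rwa [ZMod.card]) hinj hn
    hP (by omega) hord hPodd
    (containsPrimeCoset_of_charSum_eq_zero hP hPQ m hodd hm ZMod.stdAddChar hinj)
    (diffCount f v) (by rw [charSum_diffCount, hf v hv]) (sum_diffCount f v) hlt
    (diffCount_neg f v)
  have hdiff : ∀ x y, f y - f x = 0 ∨ (addOrderOf (f y - f x)).Prime := by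
    intro x y
    by_cases hxy : y - x = 0
    · left; rw [sub_eq_zero.1 hxy, sub_self]
    · obtain ⟨-, -, -, -, -, -, -, h⟩ := key (y - x) hxy
      exact h _ ((diffCount_pos_iff f (y - x) _).2 ⟨x, by rw [add_sub_cancel]⟩)
  obtain ⟨v, hv⟩ : ∃ v : Fin n → ZMod 2, v ≠ 0 :=
    ⟨fun _ => 1, fun h => one_ne_zero (congrFun h ⟨0, hn⟩)⟩
  obtain ⟨s, t, hs, ht, hst, hDs, hDt, -⟩ := key v hv
  obtain ⟨x, rfl⟩ := (diffCount_pos_iff f v s).1 hDs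
  obtain ⟨y, rfl⟩ := (diffCount_pos_iff f v t).1 hDt
  exact false_of_prime_order_differences hdiff hs ht hst

theorem corollary3p5 (m n s : ℕ) (p α : ℕ → ℕ) (hn : 1 ≤ n)
    (hprime : ∀ i ∈ Finset.Icc 1 s, (p i).Prime ∧ Odd (p i))
    (hmono : StrictMonoOn p (Set.Icc 1 s))
    (hα : ∀ i ∈ Finset.Icc 1 s, 1 ≤ α i)
    (hm : m = ∏ i ∈ Finset.Icc 1 s, p i ^ α i) :
    (s = 1 → ¬ ∃ f, IsGBF m n f) ∧
    (2 ≤ s → 2 ^ n < 3 * p 1 + p 2 → ¬ ∃ f, IsGBF m n f) ∧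
    (∀ r : ℕ, r + 1 ≤ s →
      IsLeast {q : ℕ | (∃ i ∈ Finset.Icc 1 s, q = p i) ∧ 2 ^ n < p 1 + q} (p (r + 1)) →
      (¬ ∃ f, IsGBF (∏ i ∈ Finset.Icc 1 r, p i ^ α i) n f) →
      ¬ ∃ f, IsGBF m n f) := by
  have hne : ∀ k ≤ s, ∏ i ∈ Finset.Icc 1 k, p i ^ α i ≠ 0 := by
    intro k hk
    refine Finset.prod_ne_zero_iff.2 fun i hi => pow_ne_zero _ (hprime i ?_).1.ne_zero
    rw [mem_Icc] at hi ⊢; omega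
  have hoddprod : ∀ k ≤ s, Odd (∏ i ∈ Finset.Icc 1 k, p i ^ α i) := by
    intro k hk
    refine Finset.prod_induction _ Odd (fun _ _ => Odd.mul) odd_one fun i hi => ?_
    refine (hprime i ?_).2.pow
    rw [mem_Icc] at hi ⊢; omega
  have hfac : ∀ k ≤ s, ∀ q, q.Prime → q ∣ ∏ i ∈ Finset.Icc 1 k, p i ^ α i →
      ∃ i ∈ Finset.Icc 1 k, q = p i := by
    intro k hk q hq hqd
    obtain ⟨i, hi, hqi⟩ := (Prime.dvd_finsetProd_iff hq.prime _).1 hqd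
    refine ⟨i, hi, ?_⟩
    have hi' : i ∈ Finset.Icc 1 s := by rw [mem_Icc] at hi ⊢; omega
    exact (Nat.prime_dvd_prime_iff_eq hq (hprime i hi').1).1 (hq.dvd_of_dvd_pow hqi)
  have hle : ∀ i j, 1 ≤ i → i ≤ j → j ≤ s → p i ≤ p j := fun i j h1 h2 h3 =>
    hmono.monotoneOn ⟨h1, h2.trans h3⟩ ⟨h1.trans h2, h3⟩ h2
  have hthree : ∀ i ∈ Finset.Icc 1 s, 3 ≤ p i := by
    intro i hi
    obtain ⟨h1, k, hk⟩ := hprime i hi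
    have := h1.two_le
    omega
  refine ⟨?_, ?_, ?_⟩
  · rintro rfl
    obtain ⟨h1, h2⟩ := hprime 1 (by simp)
    obtain ⟨a, ha⟩ := Nat.exists_eq_add_of_le' (hα 1 (by simp))
    rw [Finset.Icc_self, Finset.prod_singleton, ha] at hm
    rw [hm]
    exact not_exists_isGBF_primePow hn h1 h2
  · intro hs hlt
    have h1 : 1 ∈ Finset.Icc 1 s := by rw [mem_Icc]; omega
    have h2 : 2 ∈ Finset.Icc 1 s := by rw [mem_Icc]; omega
    have h12 : p 1 + 2 ≤ p 2 := by
      have := hmono (a := 1) (b := 2) ⟨le_rfl, by omega⟩ ⟨by omega, hs⟩ (by omega)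
      obtain ⟨a, ha⟩ := (hprime 1 h1).2
      obtain ⟨b, hb⟩ := (hprime 2 h2).2
      omega
    subst hm
    refine not_exists_isGBF_of_lt hn (hne s le_rfl) (hoddprod s le_rfl) (hthree 1 h1)
      (hprime 1 h1).2 h12 ?_ hlt
    intro q hq hqd
    obtain ⟨i, hi, rfl⟩ := hfac s le_rfl q hq hqd
    rw [mem_Icc] at hi
    rcases Nat.lt_or_ge 1 i with h | h
    · exact Or.inr (hle 2 i (by omega) h hi.2)
    · left; congr 1; omega
  · rintro r hr ⟨⟨-, hlt⟩, -⟩ hno hex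
    apply hno
    have h1 : 1 ∈ Finset.Icc 1 s := by rw [mem_Icc]; omega
    -- The largest prime is removed each time. Every removed prime is at least p (r + 1), so its sum
    -- with p 1 still exceeds 2ⁿ.
    have step : ∀ d, r + d ≤ s → (∃ f, IsGBF (∏ i ∈ Finset.Icc 1 (r + d), p i ^ α i) n f) →
        ∃ f, IsGBF (∏ i ∈ Finset.Icc 1 r, p i ^ α i) n f := by
      intro d
      induction d with
      | zero => exact fun _ h => h
      | succ d ih =>
        intro hd h
        refine ih (by omega) ?_
        have hmem : r + d + 1 ∈ Finset.Icc 1 s := by rw [mem_Icc]; omega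
        obtain ⟨a, ha⟩ := Nat.exists_eq_add_of_le' (hα _ hmem)
        rw [← add_assoc, Finset.prod_Icc_succ_top (by omega), ha] at h
        obtain ⟨hq, hqodd⟩ := hprime _ hmem
        refine exists_isGBF_of_mul_primePow (P := p 1) (hne _ (by omega)) (hoddprod _ (by omega))
          hq hqodd ?_ (hthree 1 h1) (hprime 1 h1).2 ?_ (hle _ _ le_rfl (by omega) (by omega)) ?_ h
        · rw [Nat.Prime.coprime_iff_not_dvd hq]
          intro hdvd
          obtain ⟨i, hi, hpi⟩ := hfac _ (by omega) _ hq hdvd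
          rw [mem_Icc] at hi
          have := hmono (a := i) (b := r + d + 1) ⟨hi.1, by omega⟩ ⟨by omega, by omega⟩ (by omega)
          omega
        · intro l hl hld
          obtain ⟨i, hi, rfl⟩ := hfac _ (by omega) l hl hld
          rw [mem_Icc] at hi
          exact hle _ _ le_rfl hi.1 (by omega)
        · have := hle (r + 1) (r + d + 1) (by omega) (by omega) (by omega)
          omega
    obtain ⟨d, rfl⟩ := Nat.exists_eq_add_of_le (show r ≤ s by omega)
    exact step d le_rfl (hm ▸ hex)
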